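/- Let $\Omega\subseteq\mathbb{R}^N$ ($N\ge 1$) be a bounded domain with $C^2$-boundary and let $2<p<\infty$. Let $W^{1,p}_0(\Omega)$ be normed by $\|u\|=\|Du\|_p$. Let $f:\Omega\times\mathbb{R}\to\mathbb{R}$ be a Carathéodory function (measurable in $z$ for every $x$, continuous in $x$ for almost every $z$), put $F(z,x)=\int_0^x f(z,s)\,ds$, and assume: (i) for every $\rho>0$ there is $a_\rho\in L^\infty(\Omega)$, $a_\rho\ge 0$, such that $|f(z,x)|\le a_\rho(z)$ for almost all $z\in\Omega$ and all $|x|\le\rho$; (ii) there is an integer $m\ge 1$ such that $\lim_{x\to\pm\infty}\frac{f(z,x)}{|x|^{p-2}x}=\hat\lambda_m(p)$ uniformly for almost all $z\in\Omega$; (iii) there are $\tau\in(2,p)$ and $\beta_0>0$ such that $\beta_0\le\liminf_{x\to\pm\infty}\frac{f(z,x)x-pF(z,x)}{|x|^\tau}$ uniformly for almost all $z\in\Omega$. Here $\hat\lambda_m(p)$ is the $m$-th variational eigenvalue of $(-\Delta_p,W^{1,p}_0(\Omega))$, namely $$\hat\lambda_m(p)=\inf_{A}\ \max_{u\in A}\|Du\|_p^p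 ,$$ the infimum being over the compact symmetric sets $A\subseteq\{u\in W^{1,p}_0(\Omega):\|u\|_p=1\}$ whose Fadell–Rabinowitz cohomological index is at least $m$. (The index of $A$ is the supremum of the integers $k+1$, $k\ge 0$, such that $c^*(\omega^k)\ne 0$ in the Alexander–Spanier cohomology group $H^k(A/\{\pm1\};\mathbb{Z}/2)$, where $c:A/\{\pm1\}\to\mathbb{RP}^\infty$ is the classifying map of the double covering $A\to A/\{\pm1\}$ and $\omega$ is the generator of $H^1(\mathbb{RP}^\infty;\mathbb{Z}/2)$; the index of $\emptyset$ is $0$.) Then the energy functional $$\varphi(u)=\frac1p\|Du\|_p^p+\frac12\|Du\|_2^2-\int_\Omega F(z,u(z))\,dz,\qquad u\in W^{1,p}_0(\Omega),$$ is well defined (the function $z\mapsto F(z,u(z))$ is integrable for every $u$), belongs to $C^1(W^{1,p}_0(\Omega),\mathbb{R})$, and satisfies the Cerami condition: every sequence $(u_n)$ in $W^{1,p}_0(\Omega)$ such that $(\varphi(u_n))$ is bounded and $(1+\|u_n\|)\varphi'(u_n)\to 0$ in $W^{1,p}_0(\Omega)^*$ has a strongly convergent subsequence. -/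

import Mathlib

open MeasureTheory Filter Topology
open scoped ContDiff Gradient ENNReal

noncomputable section

/-! ### Bounded domains with boundary of class `C²` -/

/-- A bounded domain (nonempty connected open set) of `ℝ^N` with boundary of class `C²`:
near each boundary point the domain is `{g < 0}` for a `C²` function `g` with nonzero
differential. -/
structure BoundedC2Domain (N : ℕ) where
  carrier : Set (EuclideanSpace ℝ (Fin N))
  isOpen : IsOpen carrier
  isConnected : IsConnected carrier
  isBounded : Bornology.IsBounded carrier
  c2_boundary : ∀ x ∈ frontier carrier, ∃ g : EuclideanSpace ℝ (Fin N) → ℝ,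
    ContDiffAt ℝ 2 g x ∧ fderiv ℝ g x ≠ 0 ∧ ∀ᶠ y in 𝓝 x, (y ∈ carrier ↔ g y < 0)

/-- Lebesgue measure on the domain. -/
abbrev BoundedC2Domain.vol {N : ℕ} (Ω : BoundedC2Domain N) :
    Measure (EuclideanSpace ℝ (Fin N)) :=
  volume.restrict Ω.carrier

instance fact_one_le_ofReal (p : ℝ) [hp : Fact (1 < p)] : Fact (1 ≤ ENNReal.ofReal p) :=
  ⟨by simpa using ENNReal.ofReal_le_ofReal hp.out.le⟩

/-! ### The Sobolev space `W₀^{1,p}(Ω)` -/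

/-- `φ ∈ C_c^∞(Ω)`. -/
structure IsTestFunction {N : ℕ} (Ω : BoundedC2Domain N)
    (φ : EuclideanSpace ℝ (Fin N) → ℝ) : Prop where
  contDiff : ContDiff ℝ ∞ φ
  hasCompactSupport : HasCompactSupport φ
  tsupport_subset : tsupport φ ⊆ Ω.carrier

theorem IsTestFunction.differentiableAt {N : ℕ} {Ω : BoundedC2Domain N}
    {φ : EuclideanSpace ℝ (Fin N) → ℝ} (h : IsTestFunction Ω φ)
    (x : EuclideanSpace ℝ (Fin N)) : DifferentiableAt ℝ φ x :=
  h.contDiff.differentiable (by simp) x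

/-- The pairs `(φ, ∇φ)`, `φ ∈ C_c^∞(Ω)`, as a linear subspace of `L^p(Ω) × L^p(Ω; ℝ^N)`. -/
def testPairs {N : ℕ} (Ω : BoundedC2Domain N) (p : ℝ) [Fact (1 < p)] :
    Submodule ℝ (Lp ℝ (ENNReal.ofReal p) Ω.vol ×
      Lp (EuclideanSpace ℝ (Fin N)) (ENNReal.ofReal p) Ω.vol) where
  carrier := {v | ∃ φ, IsTestFunction Ω φ ∧ v.1 =ᵐ[Ω.vol] φ ∧ v.2 =ᵐ[Ω.vol] ∇ φ}
  zero_mem' := by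
    refine ⟨0, ⟨contDiff_const, HasCompactSupport.zero, by simp⟩, Lp.coeFn_zero _ _ _, ?_⟩
    filter_upwards [Lp.coeFn_zero (EuclideanSpace ℝ (Fin N)) (ENNReal.ofReal p) Ω.vol] with x hx
    simp only [Prod.snd_zero, hx, gradient, fderiv_zero]
    simp
  add_mem' := by
    rintro v w ⟨φ, hφ, h1, h2⟩ ⟨ψ, hψ, h3, h4⟩
    refine ⟨φ + ψ, ⟨hφ.contDiff.add hψ.contDiff, hφ.hasCompactSupport.add hψ.hasCompactSupport,
      (tsupport_add φ ψ).trans (Set.union_subset hφ.tsupport_subset hψ.tsupport_subset)⟩, ?_, ?_⟩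
    · exact (Lp.coeFn_add v.1 w.1).trans (h1.add h3)
    · filter_upwards [Lp.coeFn_add v.2 w.2, h2, h4] with x hx h2 h4
      simp only [Prod.snd_add, hx, Pi.add_apply, h2, h4, gradient]
      rw [fderiv_add (hφ.differentiableAt x) (hψ.differentiableAt x), map_add]
  smul_mem' := by
    rintro c v ⟨φ, hφ, h1, h2⟩
    refine ⟨c • φ, ⟨hφ.contDiff.const_smul c, hφ.hasCompactSupport.smul_left (f := fun _ => c),
      (tsupport_smul_subset_right (fun _ => c) φ).trans hφ.tsupport_subset⟩, ?_, ?_⟩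
    · exact (Lp.coeFn_smul c v.1).trans (h1.const_smul c)
    · filter_upwards [Lp.coeFn_smul c v.2, h2] with x hx h2
      simp only [Prod.smul_snd, hx, Pi.smul_apply, h2, gradient]
      rw [fderiv_const_smul (hφ.differentiableAt x), map_smul]

/-- `W₀^{1,p}(Ω)` as the closure of `C_c^∞(Ω)` in `W^{1,p}(Ω)`: an element is the pair
consisting of a function `u ∈ L^p(Ω)` and its weak gradient `Du ∈ L^p(Ω; ℝ^N)`. -/
def sobolevPairs {N : ℕ} (Ω : BoundedC2Domain N) (p : ℝ) [Fact (1 < p)] :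
    Submodule ℝ (Lp ℝ (ENNReal.ofReal p) Ω.vol ×
      Lp (EuclideanSpace ℝ (Fin N)) (ENNReal.ofReal p) Ω.vol) :=
  (testPairs Ω p).topologicalClosure

theorem poincare_test_integral {N : ℕ} [NeZero N] (Ω : BoundedC2Domain N) {p : ℝ} (hp : 1 < p)
    {R : ℝ} (hR0 : 0 ≤ R) (hR : ∀ x ∈ Ω.carrier, ‖x‖ ≤ R)
    {φ : EuclideanSpace ℝ (Fin N) → ℝ} (hφ : IsTestFunction Ω φ) :
    ∫ x in Ω.carrier, ‖φ x‖ ^ p ≤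
      2 * (2 * p * R) ^ p * ∫ x in Ω.carrier, ‖∇ φ x‖ ^ p := by
  have hp0 : 0 < p := by linarith
  have hC1 : ContDiff ℝ 1 φ := hφ.contDiff.of_le (by simp)
  have hcs := hφ.hasCompactSupport
  have hφc : Continuous φ := hC1.continuous
  have hdc : Continuous (fderiv ℝ φ) := hC1.continuous_fderiv (by simp)
  have hng : ∀ x, ‖∇ φ x‖ = ‖fderiv ℝ φ x‖ := fun x => by simp [gradient]
  have hz : ∀ x, x ∉ Ω.carrier → φ x = 0 := fun x hx =>
    image_eq_zero_of_notMem_tsupport fun h => hx (hφ.tsupport_subset h)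
  have hdz : ∀ x, x ∉ Ω.carrier → fderiv ℝ φ x = 0 := fun x hx =>
    image_eq_zero_of_notMem_tsupport
      fun h => hx (hφ.tsupport_subset (tsupport_fderiv_subset ℝ h))
  have hI1 : Integrable fun x => ‖φ x‖ ^ p :=
    (hφc.norm.rpow_const fun _ => Or.inr hp0.le).integrable_of_hasCompactSupport
      (hcs.norm.comp_left (g := fun t : ℝ => t ^ p) (Real.zero_rpow hp0.ne'))
  have hI2 : Integrable fun x => ‖fderiv ℝ φ x‖ ^ p :=
    (hdc.norm.rpow_const fun _ => Or.inr hp0.le).integrable_of_hasCompactSupport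
      ((hcs.fderiv ℝ).norm.comp_left (g := fun t : ℝ => t ^ p) (Real.zero_rpow hp0.ne'))
  have e1 : ∫ x in Ω.carrier, ‖φ x‖ ^ p = ∫ x, ‖φ x‖ ^ p :=
    setIntegral_eq_integral_of_forall_compl_eq_zero fun x hx => by
      simp [hz x hx, Real.zero_rpow hp0.ne']
  have e2 : ∫ x in Ω.carrier, ‖∇ φ x‖ ^ p = ∫ x, ‖fderiv ℝ φ x‖ ^ p := by
    simp only [hng]
    exact setIntegral_eq_integral_of_forall_compl_eq_zero fun x hx => by
      simp [hdz x hx, Real.zero_rpow hp0.ne']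
  rw [e1, e2]
  let e : EuclideanSpace ℝ (Fin N) := EuclideanSpace.single 0 1
  let ℓ : EuclideanSpace ℝ (Fin N) →L[ℝ] ℝ := EuclideanSpace.proj 0
  have hle : ℓ e = 1 := by simp [ℓ, e]
  have hln : ∀ x, |ℓ x| ≤ ‖x‖ := fun x => PiLp.norm_apply_le x 0
  have hen : ‖e‖ = 1 := by simp [e]
  let g : EuclideanSpace ℝ (Fin N) → ℝ := fun x => ‖φ x‖ ^ p
  have hgC : ContDiff ℝ 1 g := (contDiff_norm_rpow hp).comp hC1
  have hgs : HasCompactSupport g :=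
    hcs.norm.comp_left (g := fun t : ℝ => t ^ p) (Real.zero_rpow hp0.ne')
  have hgdc : Continuous (fderiv ℝ g) := hgC.continuous_fderiv (by simp)
  have hgd : ∀ x, |fderiv ℝ g x e| ≤ p * ‖φ x‖ ^ (p - 1) * ‖fderiv ℝ φ x‖ := by
    intro x
    have hd := (hasFDerivAt_norm_rpow (φ x) hp).comp x
      (hφ.differentiableAt x).hasFDerivAt
    have hd' : fderiv ℝ g x = _ := hd.fderiv
    have h3 : |fderiv ℝ φ x e| ≤ ‖fderiv ℝ φ x‖ := by
      simpa [hen] using (fderiv ℝ φ x).le_opNorm e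
    have h4 : ‖φ x‖ ^ (p - 2) * |φ x| = ‖φ x‖ ^ (p - 1) := by
      rcases eq_or_ne (φ x) 0 with h0 | h0
      · simp [h0, Real.zero_rpow (by linarith : p - 1 ≠ 0)]
      · rw [Real.norm_eq_abs, show p - 1 = (p - 2) + 1 by ring,
          Real.rpow_add_one (abs_pos.2 h0).ne']
    have h5 : fderiv ℝ g x e = p * ‖φ x‖ ^ (p - 2) * (φ x * fderiv ℝ φ x e) := by
      rw [hd']
      simp [mul_comm]
    rw [h5, abs_mul, abs_mul (φ x), abs_of_nonneg (by positivity), ← h4]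
    have : 0 ≤ p * ‖φ x‖ ^ (p - 2) * |φ x| := by positivity
    nlinarith [mul_le_mul_of_nonneg_left h3 this]
  have hI3 : Integrable fun x => ℓ x * fderiv ℝ g x e :=
    (ℓ.continuous.mul (hgdc.clm_apply continuous_const)).integrable_of_hasCompactSupport
      (((hgs.fderiv ℝ).comp_left (g := fun L : EuclideanSpace ℝ (Fin N) →L[ℝ] ℝ => L e)
        (by simp)).mul_left)
  have hparts : ∫ x, g x = - ∫ x, ℓ x * fderiv ℝ g x e := by
    rw [integral_mul_fderiv_eq_neg_fderiv_mul_of_integrable (f := fun x => ℓ x) (g := g) (v := e)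
      ?_ hI3 ?_ (fun x _ => ℓ.differentiableAt) (fun x _ => hgC.differentiable (by simp) x)]
    · simp [ContinuousLinearMap.fderiv, hle]
    · simp only [ContinuousLinearMap.fderiv, hle, one_mul]
      exact hI1
    · exact (ℓ.continuous.mul hgC.continuous).integrable_of_hasCompactSupport hgs.mul_left
  have hpt : ∀ x, -(ℓ x * fderiv ℝ g x e) ≤
      1 / 2 * ‖φ x‖ ^ p + (2 * p * R) ^ p * ‖fderiv ℝ φ x‖ ^ p := by
    intro x
    by_cases hx : x ∈ Ω.carrier
    · set t := ‖φ x‖ with ht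
      set s := p * R * ‖fderiv ℝ φ x‖ with hs
      have ht0 : 0 ≤ t := norm_nonneg _
      have hs0 : 0 ≤ s := by positivity
      have h1 : -(ℓ x * fderiv ℝ g x e) ≤ t ^ (p - 1) * s := by
        refine (neg_le_abs _).trans ?_
        rw [abs_mul]
        refine (mul_le_mul ((hln x).trans (hR x hx)) (hgd x) (abs_nonneg _) hR0).trans ?_
        rw [hs]
        exact le_of_eq (by ring)
      have h2 : (2 * p * R) ^ p * ‖fderiv ℝ φ x‖ ^ p = (2 * s) ^ p := by
        rw [← Real.mul_rpow (by positivity) (norm_nonneg _), hs]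
        congr 1
        ring
      rw [h2]
      refine h1.trans ?_
      have hsplit : ∀ r : ℝ, 0 ≤ r → r ^ (p - 1) * r = r ^ p := by
        intro r hr
        rcases hr.eq_or_lt with h0 | h0
        · simp [← h0, Real.zero_rpow hp0.ne']
        · rw [← Real.rpow_add_one h0.ne', sub_add_cancel]
      rcases le_total (2 * s) t with h | h
      · have : t ^ (p - 1) * s ≤ t ^ (p - 1) * (t / 2) :=
          mul_le_mul_of_nonneg_left (by linarith) (by positivity)
        have h3 := hsplit t ht0
        have h4 : 0 ≤ (2 * s) ^ p := by positivity
        linarith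
      · have h3 : t ^ (p - 1) ≤ (2 * s) ^ (p - 1) :=
          Real.rpow_le_rpow ht0 h (by linarith)
        have h4 : t ^ (p - 1) * s ≤ (2 * s) ^ (p - 1) * (2 * s) :=
          mul_le_mul h3 (by linarith) hs0 (by positivity)
        have h5 := hsplit (2 * s) (by positivity)
        have h6 : 0 ≤ t ^ p := by positivity
        linarith
    · have h0 : fderiv ℝ g x e = 0 := by
        have := hgd x
        rw [hdz x hx, norm_zero, mul_zero] at this
        exact abs_nonpos_iff.1 this
      rw [h0, mul_zero, neg_zero]
      positivity
  have hmono : ∫ x, g x ≤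
      1 / 2 * (∫ x, ‖φ x‖ ^ p) + (2 * p * R) ^ p * ∫ x, ‖fderiv ℝ φ x‖ ^ p := by
    refine (hparts.trans (integral_neg _).symm).trans_le ?_
    refine le_of_le_of_eq (b := ∫ x, (1 / 2 * ‖φ x‖ ^ p + (2 * p * R) ^ p * ‖fderiv ℝ φ x‖ ^ p))
      ?_ (by rw [integral_add (hI1.const_mul _) (hI2.const_mul _), integral_const_mul,
        integral_const_mul])
    exact integral_mono hI3.neg ((hI1.const_mul _).add (hI2.const_mul _)) hpt
  have hg : ∫ x, g x = ∫ x, ‖φ x‖ ^ p := rfl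
  rw [hg] at hmono
  linarith

theorem Lp_norm_rpow_eq {α G : Type*} [MeasurableSpace α] {μ : Measure α} [NormedAddCommGroup G]
    {p : ℝ} (hp : 1 < p) (u : Lp G (ENNReal.ofReal p) μ) :
    ‖u‖ ^ p = ∫ x, ‖u x‖ ^ p ∂μ := by
  have hp0 : 0 < p := by linarith
  have h0 : 0 ≤ ∫ x, ‖u x‖ ^ p ∂μ := integral_nonneg fun x => by positivity
  rw [Lp.norm_def, (Lp.memLp u).eLpNorm_eq_integral_rpow_norm (by simpa using hp0) (by simp),
    ENNReal.toReal_ofReal hp0.le, ENNReal.toReal_ofReal (by positivity),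
    Real.rpow_inv_rpow h0 hp0.ne']

/-- Poincaré's inequality. -/
theorem poincare {N : ℕ} [NeZero N] (Ω : BoundedC2Domain N) (p : ℝ) [hp : Fact (1 < p)] :
    ∃ C : ℝ, 0 ≤ C ∧ ∀ v ∈ sobolevPairs Ω p, ‖v.1‖ ≤ C * ‖v.2‖ := by
  obtain ⟨R, hR⟩ := Ω.isBounded.exists_norm_le
  have hp1 : 1 < p := hp.out
  have hp0 : 0 < p := by linarith
  set R' := max R 0
  have hR0 : 0 ≤ R' := le_max_right _ _
  have hR' : ∀ x ∈ Ω.carrier, ‖x‖ ≤ R' := fun x hx => (hR x hx).trans (le_max_left _ _)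
  set K : ℝ := 2 * (2 * p * R') ^ p with hK
  have hK0 : 0 ≤ K := by positivity
  refine ⟨K ^ p⁻¹, by positivity, fun v hv => ?_⟩
  have hcl : IsClosed {v : Lp ℝ (ENNReal.ofReal p) Ω.vol ×
      Lp (EuclideanSpace ℝ (Fin N)) (ENNReal.ofReal p) Ω.vol | ‖v.1‖ ≤ K ^ p⁻¹ * ‖v.2‖} :=
    isClosed_le (by fun_prop) (by fun_prop)
  have hv' : v ∈ closure (testPairs Ω p : Set (Lp ℝ (ENNReal.ofReal p) Ω.vol ×
      Lp (EuclideanSpace ℝ (Fin N)) (ENNReal.ofReal p) Ω.vol)) := by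
    rw [← Submodule.topologicalClosure_coe]
    exact hv
  refine closure_minimal ?_ hcl hv'
  rintro w ⟨φ, hφ, h1, h2⟩
  have key := poincare_test_integral Ω hp1 hR0 hR' hφ
  have e1 : ‖w.1‖ ^ p = ∫ x in Ω.carrier, ‖φ x‖ ^ p := by
    rw [Lp_norm_rpow_eq hp1]
    exact integral_congr_ae (h1.mono fun x hx => by simp only [hx])
  have e2 : ‖w.2‖ ^ p = ∫ x in Ω.carrier, ‖∇ φ x‖ ^ p := by
    rw [Lp_norm_rpow_eq hp1]
    exact integral_congr_ae (h2.mono fun x hx => by simp only [hx])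
  rw [← e1, ← e2] at key
  rw [Set.mem_ofPred_eq, ← Real.rpow_le_rpow_iff (norm_nonneg _) (by positivity) hp0,
    Real.mul_rpow (by positivity) (norm_nonneg _), Real.rpow_inv_rpow hK0 hp0.ne']
  exact key

/-- The Sobolev space `W₀^{1,p}(Ω)`, normed by `‖u‖ = ‖Du‖_p`. -/
def SobolevW0 {N : ℕ} (Ω : BoundedC2Domain N) (p : ℝ) [Fact (1 < p)] : Type :=
  ↥(sobolevPairs Ω p)

namespace SobolevW0

variable {N : ℕ} {Ω : BoundedC2Domain N} {p : ℝ} [Fact (1 < p)]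

instance : AddCommGroup (SobolevW0 Ω p) := inferInstanceAs (AddCommGroup ↥(sobolevPairs Ω p))

instance : Module ℝ (SobolevW0 Ω p) := inferInstanceAs (Module ℝ ↥(sobolevPairs Ω p))

/-- The function underlying an element of `W₀^{1,p}(Ω)`. -/
def toLp : SobolevW0 Ω p →ₗ[ℝ] Lp ℝ (ENNReal.ofReal p) Ω.vol :=
  (LinearMap.fst ℝ _ _).comp (sobolevPairs Ω p).subtype

/-- The weak gradient `Du` of an element of `W₀^{1,p}(Ω)`. -/
def grad : SobolevW0 Ω p →ₗ[ℝ] Lp (EuclideanSpace ℝ (Fin N)) (ENNReal.ofReal p) Ω.vol :=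
  (LinearMap.snd ℝ _ _).comp (sobolevPairs Ω p).subtype

theorem grad_injective [NeZero N] : Function.Injective (grad (Ω := Ω) (p := p)) := by
  obtain ⟨C, -, hC⟩ := poincare Ω p
  refine (injective_iff_map_eq_zero _).2 fun u hu => ?_
  have h2 : (u : ↥(sobolevPairs Ω p)).1.2 = 0 := hu
  have h1 := hC _ (u : ↥(sobolevPairs Ω p)).2
  rw [h2, norm_zero, mul_zero] at h1
  exact Subtype.ext (Prod.ext (norm_le_zero_iff.1 h1) h2)

instance [NeZero N] : NormedAddCommGroup (SobolevW0 Ω p) :=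
  NormedAddCommGroup.induced _ _ grad grad_injective

instance [NeZero N] : NormedSpace ℝ (SobolevW0 Ω p) :=
  NormedSpace.induced ℝ _ _ grad

theorem norm_def [NeZero N] (u : SobolevW0 Ω p) : ‖u‖ = ‖grad u‖ := rfl

instance [NeZero N] : CompleteSpace (SobolevW0 Ω p) := by
  obtain ⟨C, hC0, hC⟩ := poincare Ω p
  refine Metric.complete_of_cauchySeq_tendsto fun u hu => ?_
  have hg : CauchySeq fun n => grad (u n) := by
    rw [Metric.cauchySeq_iff] at hu ⊢
    intro ε hε
    obtain ⟨n₀, h⟩ := hu ε hε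
    exact ⟨n₀, fun m hm n hn => by
      simpa [dist_eq_norm, norm_def] using h m hm n hn⟩
  have ht : CauchySeq fun n => toLp (u n) := by
    rw [Metric.cauchySeq_iff] at hu ⊢
    intro ε hε
    obtain ⟨n₀, h⟩ := hu (ε / (C + 1)) (by positivity)
    refine ⟨n₀, fun m hm n hn => ?_⟩
    have h1 := h m hm n hn
    rw [dist_eq_norm] at h1
    rw [dist_eq_norm, ← map_sub]
    have h2 : ‖toLp (u m - u n)‖ ≤ C * ‖u m - u n‖ := hC _ (u m - u n : ↥(sobolevPairs Ω p)).2
    rw [lt_div_iff₀ (by positivity)] at h1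
    nlinarith [norm_nonneg (u m - u n)]
  obtain ⟨a, ha⟩ := cauchySeq_tendsto_of_complete ht
  obtain ⟨b, hb⟩ := cauchySeq_tendsto_of_complete hg
  have hmem : (a, b) ∈ sobolevPairs Ω p :=
    (testPairs Ω p).isClosed_topologicalClosure.mem_of_tendsto (ha.prodMk_nhds hb)
      (Eventually.of_forall fun n => (u n : ↥(sobolevPairs Ω p)).2)
  let v : SobolevW0 Ω p := (⟨(a, b), hmem⟩ : ↥(sobolevPairs Ω p))
  refine ⟨v, tendsto_iff_norm_sub_tendsto_zero.2 ?_⟩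
  have hv : grad v = b := rfl
  simpa [norm_def, hv] using tendsto_iff_norm_sub_tendsto_zero.1 hb

end SobolevW0

/-! ### Alexander–Spanier cohomology with coefficients in `ℤ/2` -/

namespace AlexanderSpanier

/-- Functions `Y^{q+1} → ℤ/2`; the `q`-cochains of `Y` are their classes modulo the locally
zero functions. -/
abbrev Cochain (Y : Type*) (q : ℕ) : Type _ := (Fin (q + 1) → Y) → ZMod 2

/-- `c` vanishes in a neighbourhood of the diagonal, so that it represents the zero cochain. -/
def IsLocallyZero {Y : Type*} [TopologicalSpace Y] {q : ℕ} (c : Cochain Y q) : Prop :=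
  ∀ y : Y, ∃ U ∈ 𝓝 y, ∀ x : Fin (q + 1) → Y, (∀ i, x i ∈ U) → c x = 0

/-- The coboundary operator (no signs are needed modulo 2). -/
def coboundary {Y : Type*} {q : ℕ} (c : Cochain Y q) : Cochain Y (q + 1) :=
  fun x => ∑ i : Fin (q + 2), c (x ∘ i.succAbove)

/-- `c` represents a cocycle. -/
def IsCocycle {Y : Type*} [TopologicalSpace Y] {q : ℕ} (c : Cochain Y q) : Prop :=
  IsLocallyZero (coboundary c)

/-- `c` represents a coboundary, that is, the zero class in the cohomology group `H^q(Y)`. -/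
def IsCoboundary {Y : Type*} [TopologicalSpace Y] : {q : ℕ} → Cochain Y q → Prop
  | 0, c => IsLocallyZero c
  | q + 1, c => ∃ b : Cochain Y q, IsLocallyZero (c - coboundary b)

/-- The `k`-fold cup product `w ⌣ ⋯ ⌣ w` of a `1`-cochain; it is the unit of `H^0` for `k = 0`. -/
def cupPow {Y : Type*} (w : Cochain Y 1) (k : ℕ) : Cochain Y k :=
  fun x => ∏ i : Fin k, w ![x i.castSucc, x i.succ]

/-- The pull-back of a cochain. -/
def pullback {Y Z : Type*} {q : ℕ} (f : Y → Z) (c : Cochain Z q) : Cochain Y q :=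
  fun x => c (f ∘ x)

end AlexanderSpanier

/-! ### The Fadell–Rabinowitz cohomological index -/

/-- The identification of antipodal points of `A`. -/
def antipodalSetoid {V : Type*} [AddGroup V] (A : Set V) : Setoid A where
  r x y := (x : V) = y ∨ (x : V) = -(y : V)
  iseqv := by
    refine ⟨fun x => Or.inl rfl, ?_, ?_⟩
    · rintro x y (h | h)
      · exact Or.inl h.symm
      · exact Or.inr (by rw [h, neg_neg])
    · rintro x y z (h | h) (h' | h')
      · exact Or.inl (h.trans h')
      · exact Or.inr (h.trans h')
      · exact Or.inr (by rw [h, h'])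
      · exact Or.inl (by rw [h, h', neg_neg])

/-- The orbit space `A / {±1}` with the quotient topology. -/
abbrev OrbitSpace {V : Type*} [AddGroup V] (A : Set V) : Type _ := Quotient (antipodalSetoid A)

/-- The infinite-dimensional sphere: the unit sphere of `ℓ²`. -/
abbrev infSphere : Set (lp (fun _ : ℕ => ℝ) 2) := Metric.sphere 0 1

/-- The infinite-dimensional real projective space. -/
abbrev RPInf : Type := OrbitSpace infSphere

/-- `f : A / {±1} → ℝP^∞` is a classifying map of the double covering `A → A / {±1}`, that is,
it is covered by a continuous odd map `A → S^∞`. -/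
def IsClassifyingMap {V : Type*} [AddGroup V] [TopologicalSpace V] (A : Set V)
    (f : OrbitSpace A → RPInf) : Prop :=
  ∃ g : A → infSphere, Continuous g ∧
    (∀ x y : A, (y : V) = -(x : V) → (g y : lp (fun _ : ℕ => ℝ) 2) = -(g x)) ∧
    ∀ x : A, f (Quotient.mk _ x) = Quotient.mk _ (g x)

/-- `w` represents the nonzero element of `H¹(ℝP^∞; ℤ/2) = ℤ/2`. -/
def IsGenerator (w : AlexanderSpanier.Cochain RPInf 1) : Prop :=
  AlexanderSpanier.IsCocycle w ∧ ¬ AlexanderSpanier.IsCoboundary w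

/-- The Fadell–Rabinowitz cohomological index of a symmetric set `A` with `0 ∉ A`: the supremum
of all `k + 1` such that `f^*(ω^k) ≠ 0` in `H^k(A / {±1}; ℤ/2)`, where `f` is the classifying map
and `ω` the generator of `H¹(ℝP^∞; ℤ/2)`. It is `0` for the empty set. -/
def cohomologicalIndex {V : Type*} [AddGroup V] [TopologicalSpace V] (A : Set V) : ℕ∞ :=
  sSup {n : ℕ∞ | ∃ k : ℕ, n = (k : ℕ∞) + 1 ∧ ∃ f : OrbitSpace A → RPInf, IsClassifyingMap A f ∧
    ∃ w, IsGenerator w ∧ ¬ AlexanderSpanier.IsCoboundary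
      (AlexanderSpanier.pullback f (AlexanderSpanier.cupPow w k))}

/-! ### The variational eigenvalues of the `p`-Laplacian -/

/-- The variational eigenvalue `λ̂_m(p)` of `(-Δ_p, W₀^{1,p}(Ω))`, `m ≥ 1`: the infimum of
`max_{u ∈ A} ‖Du‖_p^p` over the compact symmetric subsets `A` of `{u : ‖u‖_p = 1}` of
cohomological index at least `m`. -/
def variationalEigenvalue {N : ℕ} [NeZero N] (Ω : BoundedC2Domain N) (p : ℝ) [Fact (1 < p)]
    (m : ℕ) : ℝ :=
  sInf {b : ℝ | ∃ A : Set (SobolevW0 Ω p), IsCompact A ∧ (∀ u ∈ A, -u ∈ A) ∧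
    (∀ u ∈ A, ‖u.toLp‖ = 1) ∧ (m : ℕ∞) ≤ cohomologicalIndex A ∧
    b = sSup ((fun u => ‖u.grad‖ ^ p) '' A)}

/-! ### The reaction term and the energy functional -/

/-- `f : Ω × ℝ → ℝ` is a Carathéodory function. -/
def IsCaratheodory {N : ℕ} (Ω : BoundedC2Domain N)
    (f : EuclideanSpace ℝ (Fin N) → ℝ → ℝ) : Prop :=
  (∀ x : ℝ, AEMeasurable (fun z => f z x) Ω.vol) ∧ ∀ᵐ z ∂Ω.vol, Continuous (f z)

/-- `F(z, x) = ∫₀ˣ f(z, s) ds`. -/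
def primitive {N : ℕ} (f : EuclideanSpace ℝ (Fin N) → ℝ → ℝ)
    (z : EuclideanSpace ℝ (Fin N)) (x : ℝ) : ℝ :=
  ∫ s in (0 : ℝ)..x, f z s

/-- The energy functional
`φ(u) = (1/p) ‖Du‖_p^p + (1/2) ‖Du‖_2^2 - ∫_Ω F(z, u(z)) dz` on `W₀^{1,p}(Ω)`. -/
def energy {N : ℕ} (Ω : BoundedC2Domain N) (p : ℝ) [Fact (1 < p)]
    (f : EuclideanSpace ℝ (Fin N) → ℝ → ℝ) (u : SobolevW0 Ω p) : ℝ :=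
  1 / p * (∫ z, ‖u.grad z‖ ^ p ∂Ω.vol) + 1 / 2 * (∫ z, ‖u.grad z‖ ^ 2 ∂Ω.vol)
    - ∫ z, primitive f z (u.toLp z) ∂Ω.vol

/-- `φ` is a `C¹` functional on the Banach space `X` that satisfies the Cerami condition. -/
def SatisfiesCerami {X : Type*} [NormedAddCommGroup X] [NormedSpace ℝ X] [CompleteSpace X]
    (φ : X → ℝ) : Prop :=
  ContDiff ℝ 1 φ ∧
  ∀ u : ℕ → X, (∃ M : ℝ, ∀ n, |φ (u n)| ≤ M) →
    Tendsto (fun n => (1 + ‖u n‖) • fderiv ℝ φ (u n)) atTop (𝓝 0) →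
    ∃ s : ℕ → ℕ, StrictMono s ∧ ∃ v : X, Tendsto (fun n => u (s n)) atTop (𝓝 v)

end

/-! ### Nemytskii operators and integral functionals on `L^p` -/

section Nemytskii

variable {α E F : Type*} [MeasurableSpace α] {μ : Measure α} [IsFiniteMeasure μ]
  [NormedAddCommGroup E] [NormedAddCommGroup F]

/-! Hypotheses (i) and (ii) give `|f(z,x)| ≤ C(1 + |x|^(p-1))`. Superposition by such an `f` is
continuous from `L^p` to `L^{p'}`, so `u ↦ ∫ F(z,u)` is `C¹` on `L^p`. The gradient terms are
treated the same way (`IsPotential.exists_hasFDerivAt`), and the energy is the composite with the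
bounded linear maps `u ↦ u` and `u ↦ Du`.

A Cerami sequence is bounded by a direct estimate, without rescaling. In `pφ(u) - φ'(u)u` the `p`-th
powers of `Du` cancel, leaving `(p/2 - 1)‖Du‖₂² + ∫ (f(z,u)u - pF(z,u))`. The first term is
nonnegative since `p > 2`; by (iii) the integrand is at least `c|u| - K`. This bounds `u` in `L¹`.
Boundedness of `φ'(u)u` gives `‖Du‖_p^p ≤ const + 2C‖u‖_p^p`, and Ehrling's inequality `‖u‖_p ≤
ε‖Du‖_p + C_ε‖u‖₁` absorbs the last term for small `ε` (`exists_norm_le_of_cerami`).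

By Rellich's theorem a subsequence converges in `L^p`, so the reaction part of `φ'` converges along
it in the dual. As `φ' → 0`, the differential part converges too; it is strongly monotone, which
makes the subsequence Cauchy in norm. Rellich and Ehrling both follow from one finite-rank averaging
operator, `exists_compact_approx`. -/

theorem memLp_comp_of_growth {r : ℝ} (hr : 0 < r) {p q : ℝ≥0∞}
    (hpq : q * ENNReal.ofReal r = p) {k : α → E → F} {C : ℝ}
    (hb : ∀ᵐ z ∂μ, ∀ x, ‖k z x‖ ≤ C * (1 + ‖x‖ ^ r)) {v : α → E} (hv : MemLp v p μ)
    (hm : AEStronglyMeasurable (fun z => k z (v z)) μ) :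
    MemLp (fun z => k z (v z)) q μ := by
  have h1 : MemLp (fun z => ‖v z‖ ^ r) q μ := by
    refine ⟨(hv.1.norm.aemeasurable.pow_const r).aestronglyMeasurable, ?_⟩
    rw [eLpNorm_norm_rpow _ hr, hpq]
    exact ENNReal.rpow_lt_top_of_nonneg hr.le hv.2.ne
  have h0 : MemLp (fun _ : α => (1 : ℝ)) q μ := memLp_const 1
  have h2 : MemLp (fun z => C * (1 + ‖v z‖ ^ r)) q μ := (h0.add h1).const_mul C
  exact h2.of_le hm (hb.mono fun z hz => (hz _).trans (le_abs_self _))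

/-- The growth bound dominates the composites by `1 + ‖v‖^r`, and `qr = p` carries uniform
integrability in `L^p` over to these powers in `L^q`. This is the input for Vitali's theorem. -/
theorem unifIntegrable_comp_of_growth {r : ℝ} (hr : 0 < r) {p q : ℝ≥0∞} (hq : 1 ≤ q)
    (hq' : q ≠ ⊤) (hpq : q * ENNReal.ofReal r = p) {k : α → E → F} {C : ℝ}
    (hb : ∀ᵐ z ∂μ, ∀ x, ‖k z x‖ ≤ C * (1 + ‖x‖ ^ r)) {ι : Type*} {v : ι → α → E}
    (hv : UnifIntegrable v p μ) (hvm : ∀ i, AEStronglyMeasurable (v i) μ) :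
    UnifIntegrable (fun i z => k z (v i z)) q μ := by
  have h1 : UnifIntegrable (fun i z => ‖v i z‖ ^ r) q μ := by
    intro ε hε
    -- The `L^q` norm of `‖v‖^r` is the `r`-th power of the `L^p` norm of `v`, hence the tolerance
    -- `ε^(1/r)`.
    obtain ⟨δ, hδ, h⟩ := hv (ε := ε ^ r⁻¹) (by positivity)
    refine ⟨δ, hδ, fun i s hs hμ => ?_⟩
    have e : s.indicator (fun z => ‖v i z‖ ^ r) = fun z => ‖s.indicator (v i) z‖ ^ r := by
      ext z
      by_cases hz : z ∈ s <;> simp [hz, Real.zero_rpow hr.ne']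
    rw [e, eLpNorm_norm_rpow _ hr, hpq]
    refine (ENNReal.rpow_le_rpow (h i s hs hμ) hr.le).trans_eq ?_
    rw [ENNReal.ofReal_rpow_of_nonneg (by positivity) hr.le, Real.rpow_inv_rpow hε.le hr.ne']
  have h2 : UnifIntegrable ((fun _ : ι => fun _ : α => (1 : ℝ)) + fun i z => ‖v i z‖ ^ r) q μ :=
    (unifIntegrable_const hq hq' (memLp_const 1)).add h1 hq (fun _ => aestronglyMeasurable_const)
      fun i => ((hvm i).norm.aemeasurable.pow_const r).aestronglyMeasurable
  intro ε hε
  obtain ⟨δ, hδ, h⟩ := h2 (ε := ε / (|C| + 1)) (by positivity)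
  refine ⟨δ, hδ, fun i s hs hμ => ?_⟩
  refine (eLpNorm_le_mul_eLpNorm_of_ae_le_mul (c := |C| + 1) (hb.mono fun z hz => ?_) q).trans
    ((mul_le_mul_right (h i s hs hμ) _).trans_eq ?_)
  · by_cases hzs : z ∈ s
    · simp only [Set.indicator_of_mem hzs, Pi.add_apply]
      have h3 : 0 ≤ ‖v i z‖ ^ r := by positivity
      rw [Real.norm_of_nonneg (by positivity)]
      refine (hz _).trans (mul_le_mul_of_nonneg_right ?_ (by positivity))
      linarith [le_abs_self C]
    · simp [hzs]
  · rw [← ENNReal.ofReal_mul (by positivity), mul_div_cancel₀ _ (by positivity)]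

/-- Continuity of the Nemytskii operator. Every subsequence has a further one converging almost
everywhere; continuity of `k z` passes this to the composites, and Vitali's theorem gives
convergence in `L^q`. -/
theorem tendsto_eLpNorm_comp_of_growth {r : ℝ} (hr : 0 < r) {p q : ℝ≥0∞} (hp : 1 ≤ p)
    (hp' : p ≠ ⊤) (hq : 1 ≤ q) (hq' : q ≠ ⊤) (hpq : q * ENNReal.ofReal r = p)
    {k : α → E → F} (hk : ∀ᵐ z ∂μ, Continuous (k z))
    (hm : ∀ v : α → E, AEStronglyMeasurable v μ →
      AEStronglyMeasurable (fun z => k z (v z)) μ) {C : ℝ}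
    (hb : ∀ᵐ z ∂μ, ∀ x, ‖k z x‖ ≤ C * (1 + ‖x‖ ^ r)) {v : ℕ → α → E} {w : α → E}
    (hv : ∀ n, MemLp (v n) p μ) (hw : MemLp w p μ)
    (h : Tendsto (fun n => eLpNorm (v n - w) p μ) atTop (𝓝 0)) :
    Tendsto (fun n => eLpNorm ((fun z => k z (v n z)) - fun z => k z (w z)) q μ) atTop (𝓝 0) := by
  have hp0 : p ≠ 0 := (zero_lt_one.trans_le hp).ne'
  have hin := tendstoInMeasure_of_tendsto_eLpNorm hp0 (fun n => (hv n).1) hw.1 h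
  have hui := unifIntegrable_comp_of_growth hr hq hq' hpq hb
    (unifIntegrable_of_tendsto_Lp hp hp' hv hw h) fun n => (hv n).1
  refine tendsto_of_subseq_tendsto fun ns hns => ?_
  obtain ⟨ms, _, hms⟩ := TendstoInMeasure.exists_seq_tendsto_ae (hin.comp hns)
  refine ⟨ms, tendsto_Lp_finite_of_tendsto_ae hq hq' (fun n => hm _ (hv _).1)
    (memLp_comp_of_growth hr hpq hb hw (hm _ hw.1)) (fun ε hε => ?_) ?_⟩
  · obtain ⟨δ, hδ, hδ'⟩ := hui hε
    exact ⟨δ, hδ, fun i s hs hμs => hδ' _ s hs hμs⟩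
  · filter_upwards [hms, hk] with z hz hkz
    exact (hkz.tendsto _).comp hz

end Nemytskii

/-- `G : α × E → ℝ` is a Carathéodory function of class `C¹` in the second variable, with
differential `g` of `(p - 1)`-growth. -/
structure IsPotential {α E : Type*} [MeasurableSpace α] [NormedAddCommGroup E] [NormedSpace ℝ E]
    (μ : Measure α) (p C : ℝ) (G : α → E → ℝ) (g : α → E → E →L[ℝ] ℝ) : Prop where
  hasFDerivAt : ∀ᵐ z ∂μ, ∀ x, HasFDerivAt (G z) (g z x) x
  continuous : ∀ᵐ z ∂μ, Continuous (g z)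
  meas : ∀ v : α → E, AEStronglyMeasurable v μ → AEStronglyMeasurable (fun z => G z (v z)) μ
  meas_deriv : ∀ v : α → E, AEStronglyMeasurable v μ →
    AEStronglyMeasurable (fun z => g z (v z)) μ
  bound : ∀ᵐ z ∂μ, ∀ x, ‖G z x‖ ≤ C * (1 + ‖x‖ ^ p)
  bound_deriv : ∀ᵐ z ∂μ, ∀ x, ‖g z x‖ ≤ C * (1 + ‖x‖ ^ (p - 1))

namespace IsPotential

variable {α E : Type*} [MeasurableSpace α] [NormedAddCommGroup E] [NormedSpace ℝ E]
  {μ : Measure α} [IsFiniteMeasure μ] {p C : ℝ} {G : α → E → ℝ} {g : α → E → E →L[ℝ] ℝ}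

theorem integrable (h : IsPotential μ p C G g) (hp : 1 < p) {v : α → E}
    (hv : MemLp v (ENNReal.ofReal p) μ) : Integrable (fun z => G z (v z)) μ :=
  memLp_one_iff_integrable.1 (memLp_comp_of_growth (by linarith) (one_mul _) h.bound hv
    (h.meas _ hv.1))

theorem ofReal_conj_mul (hp : 1 < p) :
    ENNReal.ofReal (p.conjExponent) * ENNReal.ofReal (p - 1) = ENNReal.ofReal p := by
  rw [← ENNReal.ofReal_mul (Real.HolderConjugate.conjExponent hp).symm.nonneg, Real.conjExponent,
    div_mul_cancel₀ _ (by linarith)]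

theorem memLp_deriv (h : IsPotential μ p C G g) (hp : 1 < p) {v : α → E}
    (hv : MemLp v (ENNReal.ofReal p) μ) :
    MemLp (fun z => g z (v z)) (ENNReal.ofReal p.conjExponent) μ :=
  memLp_comp_of_growth (by linarith) (ofReal_conj_mul hp) h.bound_deriv hv (h.meas_deriv _ hv.1)

theorem integrable_deriv (h : IsPotential μ p C G g) (hp : 1 < p) {v w : α → E}
    (hv : MemLp v (ENNReal.ofReal p) μ) (hw : MemLp w (ENNReal.ofReal p) μ) :
    Integrable (fun z => g z (v z) (w z)) μ := by
  have := (Real.HolderConjugate.conjExponent hp).symm.ennrealOfReal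
  exact memLp_one_iff_integrable.1 <| MemLp.of_bilin (r := 1) (fun (L : E →L[ℝ] ℝ) x => L x) 1
    (h.memLp_deriv hp hv) hw
    ((ContinuousLinearMap.id ℝ (E →L[ℝ] ℝ)).aestronglyMeasurable_comp₂
      (h.meas_deriv _ hv.1) hw.1)
    (Eventually.of_forall fun z => by
      rw [one_mul]
      exact_mod_cast (g z (v z)).le_opNorm (w z))

variable [hpF : Fact (1 < p)]

/-- The differential of `v ↦ ∫ G(z, v(z)) dμ` on `L^p`. -/
theorem exists_continuous_deriv (h : IsPotential μ p C G g) :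
    ∃ D : Lp E (ENNReal.ofReal p) μ → Lp E (ENNReal.ofReal p) μ →L[ℝ] ℝ, Continuous D ∧
      ∀ v w, D v w = ∫ z, g z (v z) (w z) ∂μ := by
  have hp : 1 < p := hpF.out
  have hc := (Real.HolderConjugate.conjExponent hp).symm
  have := hc.ennrealOfReal
  have : Fact (1 ≤ ENNReal.ofReal p.conjExponent) :=
    ⟨by simpa using ENNReal.ofReal_le_ofReal hc.lt.le⟩
  -- The derivative is the Nemytskii operator of `g` into `L^{p'}`, followed by the Hölder pairing
  -- with `L^p`.
  let T : Lp E (ENNReal.ofReal p) μ → Lp (E →L[ℝ] ℝ) (ENNReal.ofReal p.conjExponent) μ :=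
    fun v => (h.memLp_deriv hp (Lp.memLp v)).toLp _
  have hT : Continuous T := by
    refine continuous_iff_seqContinuous.2 fun v w hvw => ?_
    rw [Lp.tendsto_Lp_iff_tendsto_eLpNorm']
    refine (tendsto_eLpNorm_comp_of_growth (r := p - 1) (by linarith) Fact.out
      ENNReal.ofReal_ne_top Fact.out ENNReal.ofReal_ne_top (ofReal_conj_mul hp) h.continuous
      h.meas_deriv h.bound_deriv (fun n => Lp.memLp (v n)) (Lp.memLp w)
      ((Lp.tendsto_Lp_iff_tendsto_eLpNorm' _ _).1 hvw)).congr fun n => ?_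
    exact eLpNorm_congr_ae ((h.memLp_deriv hp (Lp.memLp (v n))).coeFn_toLp.sub
      (h.memLp_deriv hp (Lp.memLp w)).coeFn_toLp).symm
  refine ⟨fun v => (ContinuousLinearMap.id ℝ (E →L[ℝ] ℝ)).lpPairing μ
    (ENNReal.ofReal p.conjExponent) (ENNReal.ofReal p) (T v),
    (ContinuousLinearMap.continuous _).comp hT, fun v w => ?_⟩
  rw [ContinuousLinearMap.lpPairing_eq_integral]
  refine integral_congr_ae ?_
  filter_upwards [(h.memLp_deriv hp (Lp.memLp v)).coeFn_toLp] with z hz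
  simp [T, hz]

/-- Differentiation under the integral sign. For `|s - t| < 1` the derivative is dominated by `C(1 +
(‖v‖ + (|t|+1)‖w‖)^(p-1))‖w‖`, which is integrable by Hölder. -/
theorem hasDerivAt_line (h : IsPotential μ p C G g) (v w : Lp E (ENNReal.ofReal p) μ) (t : ℝ) :
    HasDerivAt (fun t : ℝ => ∫ z, G z ((v + t • w : Lp E (ENNReal.ofReal p) μ) z) ∂μ)
      (∫ z, g z ((v + t • w : Lp E (ENNReal.ofReal p) μ) z) (w z) ∂μ) t := by
  have hp : 1 < p := hpF.out
  have hco : ∀ s : ℝ, ∀ᵐ z ∂μ, (v + s • w : Lp E (ENNReal.ofReal p) μ) z = v z + s • w z := by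
    intro s
    filter_upwards [Lp.coeFn_add v (s • w), Lp.coeFn_smul s w] with z h1 h2
    rw [h1, Pi.add_apply, h2, Pi.smul_apply]
  have e1 : (fun t : ℝ => ∫ z, G z ((v + t • w : Lp E (ENNReal.ofReal p) μ) z) ∂μ) =
      fun t => ∫ z, G z (v z + t • w z) ∂μ :=
    funext fun s => integral_congr_ae ((hco s).mono fun z hz => by simp only [hz])
  have e2 : ∫ z, g z ((v + t • w : Lp E (ENNReal.ofReal p) μ) z) (w z) ∂μ =
      ∫ z, g z (v z + t • w z) (w z) ∂μ :=
    integral_congr_ae ((hco t).mono fun z hz => by simp only [hz])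
  rw [e1, e2]
  have hmem : ∀ s : ℝ, MemLp (fun z => v z + s • w z) (ENNReal.ofReal p) μ := fun s =>
    (Lp.memLp v).add ((Lp.memLp w).const_smul s)
  have hb0 : MemLp (fun z => ‖v z‖ + (|t| + 1) * ‖w z‖) (ENNReal.ofReal p) μ :=
    (Lp.memLp v).norm.add ((Lp.memLp w).norm.const_mul _)
  have hc := (Real.HolderConjugate.conjExponent hp).symm
  have := hc.ennrealOfReal
  have hb1 : MemLp (fun z => C * (1 + ‖(‖v z‖ + (|t| + 1) * ‖w z‖)‖ ^ (p - 1)))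
      (ENNReal.ofReal p.conjExponent) μ := by
    refine memLp_comp_of_growth (k := fun _ (x : ℝ) => C * (1 + ‖x‖ ^ (p - 1))) (C := |C|)
      (by linarith) (ofReal_conj_mul hp) (Eventually.of_forall fun z x => ?_) hb0 ?_
    · rw [norm_mul, Real.norm_eq_abs C, Real.norm_of_nonneg (by positivity)]
    · exact ((aemeasurable_const.add
        (hb0.1.norm.aemeasurable.pow_const _)).const_mul _).aestronglyMeasurable
  have hbi : Integrable (fun z => C * (1 + ‖(‖v z‖ + (|t| + 1) * ‖w z‖)‖ ^ (p - 1)) * ‖w z‖) μ :=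
    memLp_one_iff_integrable.1 ((Lp.memLp w).norm.mul' hb1)
  refine (hasDerivAt_integral_of_dominated_loc_of_deriv_le (s := Metric.ball t 1)
    (F := fun s z => G z (v z + s • w z)) (F' := fun s z => g z (v z + s • w z) (w z))
    (Metric.ball_mem_nhds t one_pos)
    (Eventually.of_forall fun s => h.meas _ (hmem s).1) (h.integrable hp (hmem t))
    (h.integrable_deriv hp (hmem t) (Lp.memLp w)).1 ?_ hbi ?_).2
  · filter_upwards [h.bound_deriv] with z hz s hs
    have hs1 : |s| ≤ |t| + 1 := by
      have := abs_sub_abs_le_abs_sub s t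
      rw [Metric.mem_ball, Real.dist_eq] at hs
      linarith
    have hC : 0 ≤ C := by
      have := (norm_nonneg _).trans (hz 0)
      rw [norm_zero, Real.zero_rpow (by linarith)] at this
      linarith
    refine ((g z (v z + s • w z)).le_opNorm _).trans
      (mul_le_mul_of_nonneg_right ((hz _).trans ?_) (norm_nonneg _))
    have h3 : ‖v z + s • w z‖ ≤ ‖(‖v z‖ + (|t| + 1) * ‖w z‖)‖ := by
      rw [Real.norm_of_nonneg (by positivity)]
      refine (norm_add_le _ _).trans ?_
      rw [norm_smul, Real.norm_eq_abs]
      gcongr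
    have h4 := Real.rpow_le_rpow (norm_nonneg _) h3 (by linarith : 0 ≤ p - 1)
    gcongr
  · filter_upwards [h.hasFDerivAt] with z hz s _
    have h1 : HasDerivAt (fun s : ℝ => v z + s • w z) (w z) s := by
      simpa using ((hasDerivAt_id s).smul_const (w z)).const_add (v z)
    exact (hz _).comp_hasDerivAt s h1

/-- A directional derivative depending continuously on the base point is a Fréchet derivative: once
its linear part at `v` is removed, the functional along a short segment has derivative at most
`c‖w‖`, and the mean value inequality applies. -/
theorem exists_hasFDerivAt (h : IsPotential μ p C G g) :
    ∃ D : Lp E (ENNReal.ofReal p) μ → Lp E (ENNReal.ofReal p) μ →L[ℝ] ℝ, Continuous D ∧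
      (∀ v w, D v w = ∫ z, g z (v z) (w z) ∂μ) ∧
      ∀ v, HasFDerivAt (fun u : Lp E (ENNReal.ofReal p) μ => ∫ z, G z (u z) ∂μ) (D v) v := by
  obtain ⟨D, hDc, hD⟩ := h.exists_continuous_deriv
  refine ⟨D, hDc, hD, fun v => ?_⟩
  rw [hasFDerivAt_iff_isLittleO_nhds_zero, Asymptotics.isLittleO_iff]
  intro c hc
  obtain ⟨δ, hδ, hδD⟩ := Metric.continuousAt_iff.1 (hDc.continuousAt (x := v)) c hc
  filter_upwards [Metric.ball_mem_nhds 0 hδ] with w hw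
  rw [mem_ball_zero_iff] at hw
  have key := norm_image_sub_le_of_norm_deriv_le_segment_01' (C := c * ‖w‖)
    (f := fun t : ℝ => (∫ z, G z ((v + t • w : Lp E (ENNReal.ofReal p) μ) z) ∂μ) - t * D v w)
    (f' := fun t => (D (v + t • w) - D v) w)
    (fun t _ => ?_) (fun t ht => ?_)
  · simpa [sub_right_comm] using key
  · have h1 := (h.hasDerivAt_line v w t).fun_sub ((hasDerivAt_id' t).mul_const (D v w))
    rw [← hD, one_mul] at h1
    exact h1.hasDerivWithinAt
  · refine ((D (v + t • w) - D v).le_opNorm w).trans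
      (mul_le_mul_of_nonneg_right ?_ (norm_nonneg _))
    rw [← dist_eq_norm]
    refine (hδD ?_).le
    rw [dist_eq_norm, add_sub_cancel_left, norm_smul, Real.norm_of_nonneg ht.1]
    nlinarith [norm_nonneg w, ht.1, ht.2]

end IsPotential

/-! ### Compactness of the embedding `W₀^{1,p}(Ω) ⊆ L^p(Ω)` -/

/-- Jensen's inequality for `t ↦ t^p`, obtained from Hölder against the constant `1`. -/
theorem lintegral_rpow_le_lintegral_rpow {α : Type*} [MeasurableSpace α] {ν : Measure α}
    [IsProbabilityMeasure ν] {p : ℝ} (hp : 1 ≤ p) {f : α → ℝ≥0∞} (hf : AEMeasurable f ν) :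
    (∫⁻ x, f x ∂ν) ^ p ≤ ∫⁻ x, f x ^ p ∂ν := by
  have hp0 : 0 < p := by linarith
  rcases hp.eq_or_lt with rfl | hp1
  · simp
  have h := ENNReal.lintegral_mul_le_Lp_mul_Lq ν (Real.HolderConjugate.conjExponent hp1) hf
    (aemeasurable_const (b := (1 : ℝ≥0∞)))
  simp only [Pi.mul_apply, mul_one, ENNReal.one_rpow, lintegral_const, measure_univ] at h
  calc (∫⁻ x, f x ∂ν) ^ p ≤ ((∫⁻ x, f x ^ p ∂ν) ^ (1 / p)) ^ p :=
        ENNReal.rpow_le_rpow h hp0.le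
    _ = _ := by rw [← ENNReal.rpow_mul, one_div_mul_cancel hp0.ne', ENNReal.rpow_one]

/-- The increment is the integral of the derivative along the segment from `x` to `x + y`. Jensen in
the parameter `t`, Tonelli, and translation invariance in `x` give the bound. -/
theorem lintegral_translate_sub_le {E : Type*} [NormedAddCommGroup E] [NormedSpace ℝ E]
    [FiniteDimensional ℝ E] [MeasurableSpace E] [BorelSpace E] (μ : Measure E)
    [μ.IsAddHaarMeasure] {φ : E → ℝ} (hφ : ContDiff ℝ 1 φ) {p : ℝ} (hp : 1 ≤ p) (y : E) :
    ∫⁻ x, ‖φ (x + y) - φ x‖ₑ ^ p ∂μ ≤ ‖y‖ₑ ^ p * ∫⁻ x, ‖fderiv ℝ φ x‖ₑ ^ p ∂μ := by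
  have hp0 : 0 < p := by linarith
  have hdc : Continuous (fderiv ℝ φ) := hφ.continuous_fderiv (by simp)
  let ν : Measure ℝ := volume.restrict (Set.Ioc 0 1)
  have : IsProbabilityMeasure ν := ⟨by simp [ν]⟩
  have hline : ∀ x, Continuous fun t : ℝ => fderiv ℝ φ (x + t • y) := fun x => by fun_prop
  have hpt : ∀ x, ‖φ (x + y) - φ x‖ₑ ^ p ≤
      ∫⁻ t, ‖y‖ₑ ^ p * ‖fderiv ℝ φ (x + t • y)‖ₑ ^ p ∂ν := by
    intro x
    have h1 : ∫ t in (0 : ℝ)..1, fderiv ℝ φ (x + t • y) y = φ (x + y) - φ x := by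
      have hd : ∀ t ∈ Set.uIcc (0 : ℝ) 1,
          HasDerivAt (fun t : ℝ => φ (x + t • y)) (fderiv ℝ φ (x + t • y) y) t := by
        intro t _
        have h2 : HasDerivAt (fun t : ℝ => x + t • y) y t := by
          simpa using ((hasDerivAt_id t).smul_const y).const_add x
        exact (hφ.differentiable (by simp) _).hasFDerivAt.comp_hasDerivAt t h2
      rw [intervalIntegral.integral_eq_sub_of_hasDerivAt hd
        (((hline x).clm_apply continuous_const).intervalIntegrable 0 1)]
      simp
    rw [intervalIntegral.integral_of_le zero_le_one] at h1
    calc ‖φ (x + y) - φ x‖ₑ ^ p ≤ (∫⁻ t, ‖y‖ₑ * ‖fderiv ℝ φ (x + t • y)‖ₑ ∂ν) ^ p := by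
          refine ENNReal.rpow_le_rpow ?_ hp0.le
          rw [← h1]
          refine (enorm_integral_le_lintegral_enorm _).trans (lintegral_mono fun t => ?_)
          rw [mul_comm]
          exact (fderiv ℝ φ (x + t • y)).le_opENorm y
      _ ≤ ∫⁻ t, (‖y‖ₑ * ‖fderiv ℝ φ (x + t • y)‖ₑ) ^ p ∂ν :=
          lintegral_rpow_le_lintegral_rpow hp
            ((hline x).enorm.measurable.const_mul _).aemeasurable
      _ = _ := by simp only [ENNReal.mul_rpow_of_nonneg _ _ hp0.le]
  have hm : Measurable (Function.uncurry fun (x : E) (t : ℝ) =>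
      ‖y‖ₑ ^ p * ‖fderiv ℝ φ (x + t • y)‖ₑ ^ p) := by
    have : Continuous fun q : E × ℝ => ‖fderiv ℝ φ (q.1 + q.2 • y)‖ₑ := by fun_prop
    exact (this.measurable.pow_const p).const_mul _
  calc ∫⁻ x, ‖φ (x + y) - φ x‖ₑ ^ p ∂μ
      ≤ ∫⁻ x, ∫⁻ t, ‖y‖ₑ ^ p * ‖fderiv ℝ φ (x + t • y)‖ₑ ^ p ∂ν ∂μ := lintegral_mono hpt
    _ = ∫⁻ t, ∫⁻ x, ‖y‖ₑ ^ p * ‖fderiv ℝ φ (x + t • y)‖ₑ ^ p ∂μ ∂ν :=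
        lintegral_lintegral_swap hm.aemeasurable
    _ = ∫⁻ _, ‖y‖ₑ ^ p * ∫⁻ x, ‖fderiv ℝ φ x‖ₑ ^ p ∂μ ∂ν := by
        refine lintegral_congr fun t => ?_
        rw [lintegral_const_mul _ (by
          have : Continuous fun x : E => ‖fderiv ℝ φ (x + t • y)‖ₑ := by fun_prop
          exact this.measurable.pow_const p),
          lintegral_add_right_eq_self (fun x => ‖fderiv ℝ φ x‖ₑ ^ p)]
    _ = _ := by simp

/-- By Jensen, the deviation from the average is controlled by the averaged `|φ x - φ y|^p`. The
ball about `i x` lies in the ball of radius `2h` about `x`, which removes the dependence on `i` at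
the cost of the volume ratio `2^dim`; each translation by `z`, `|z| < 2h`, is then estimated
separately. -/
theorem lintegral_sub_average_ball_le {E : Type*} [NormedAddCommGroup E] [NormedSpace ℝ E]
    [FiniteDimensional ℝ E] [MeasurableSpace E] [BorelSpace E] (μ : Measure E)
    [μ.IsAddHaarMeasure] {φ : E → ℝ} (hφ : ContDiff ℝ 1 φ) {p : ℝ} (hp : 1 ≤ p)
    {s : Set E} (hs : MeasurableSet s) {h : ℝ} (hh : 0 < h) {i : E → E}
    (hi : ∀ x ∈ s, dist (i x) x < h) :
    ∫⁻ x in s, ‖φ x - (μ (Metric.ball 0 h)).toReal⁻¹ *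
        ∫ y in Metric.ball (i x) h, φ y ∂μ‖ₑ ^ p ∂μ ≤
      ENNReal.ofReal (2 ^ Module.finrank ℝ E) *
        (ENNReal.ofReal (2 * h) ^ p * ∫⁻ x, ‖fderiv ℝ φ x‖ₑ ^ p ∂μ) := by
  have hp0 : 0 < p := by linarith
  set V := μ (Metric.ball (0 : E) h) with hV
  have hV0 : V ≠ 0 := (Metric.measure_ball_pos μ _ hh).ne'
  have hVt : V ≠ ⊤ := measure_ball_lt_top.ne
  have hball : ∀ c, μ (Metric.ball c h) = V := fun c => Measure.addHaar_ball_center μ c h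
  have hpt : ∀ x ∈ s, ‖φ x - V.toReal⁻¹ * ∫ y in Metric.ball (i x) h, φ y ∂μ‖ₑ ^ p ≤
      V⁻¹ * ∫⁻ z in Metric.ball 0 (2 * h), ‖φ (x + z) - φ x‖ₑ ^ p ∂μ := by
    intro x hx
    let ν : Measure E := V⁻¹ • μ.restrict (Metric.ball (i x) h)
    have : IsProbabilityMeasure ν := ⟨by
      simp [ν, hball, ENNReal.inv_mul_cancel hV0 hVt]⟩
    have hint : Integrable φ ν := by
      refine Integrable.smul_measure ?_ (by simpa using hV0)
      exact (hφ.continuous.continuousOn.integrableOn_compact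
        (isCompact_closedBall (i x) h)).mono_set Metric.ball_subset_closedBall
    have e1 : φ x - V.toReal⁻¹ * ∫ y in Metric.ball (i x) h, φ y ∂μ = ∫ y, (φ x - φ y) ∂ν := by
      rw [integral_sub (integrable_const _) hint]
      simp [ν, integral_smul_measure]
    have hmp : Measurable fun y => ‖φ y - φ x‖ₑ ^ p := by
      have : Continuous fun y => ‖φ y - φ x‖ₑ := by
        have := hφ.continuous
        fun_prop
      exact this.measurable.pow_const p
    rw [e1]
    calc ‖∫ y, (φ x - φ y) ∂ν‖ₑ ^ p ≤ (∫⁻ y, ‖φ x - φ y‖ₑ ∂ν) ^ p :=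
          ENNReal.rpow_le_rpow (enorm_integral_le_lintegral_enorm _) hp0.le
      _ ≤ ∫⁻ y, ‖φ x - φ y‖ₑ ^ p ∂ν :=
          lintegral_rpow_le_lintegral_rpow hp
            (continuous_const.sub hφ.continuous).enorm.measurable.aemeasurable
      _ = V⁻¹ * ∫⁻ y in Metric.ball (i x) h, ‖φ y - φ x‖ₑ ^ p ∂μ := by
          simp only [ν, lintegral_smul_measure, smul_eq_mul, enorm_sub_rev (φ x)]
      _ ≤ V⁻¹ * ∫⁻ y in Metric.ball x (2 * h), ‖φ y - φ x‖ₑ ^ p ∂μ := by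
          gcongr
          refine Metric.ball_subset_ball' ?_
          linarith [hi x hx]
      _ = _ := by
          congr 1
          rw [← lintegral_indicator Metric.isOpen_ball.measurableSet,
            ← lintegral_indicator Metric.isOpen_ball.measurableSet,
            ← lintegral_add_left_eq_self _ x]
          refine lintegral_congr fun z => ?_
          simp [Set.indicator]
  have hm : Measurable (Function.uncurry fun (x z : E) => ‖φ (x + z) - φ x‖ₑ ^ p) := by
    have : Continuous fun q : E × E => ‖φ (q.1 + q.2) - φ q.1‖ₑ := by
      have := hφ.continuous
      fun_prop
    exact this.measurable.pow_const p
  set I := ∫⁻ x, ‖fderiv ℝ φ x‖ₑ ^ p ∂μ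
  calc _ ≤ ∫⁻ x in s, V⁻¹ * ∫⁻ z in Metric.ball 0 (2 * h), ‖φ (x + z) - φ x‖ₑ ^ p ∂μ ∂μ :=
        setLIntegral_mono' hs hpt
    _ ≤ ∫⁻ x, V⁻¹ * ∫⁻ z in Metric.ball 0 (2 * h), ‖φ (x + z) - φ x‖ₑ ^ p ∂μ ∂μ :=
        setLIntegral_le_lintegral _ _
    _ = V⁻¹ * ∫⁻ x, ∫⁻ z in Metric.ball 0 (2 * h), ‖φ (x + z) - φ x‖ₑ ^ p ∂μ ∂μ :=
        lintegral_const_mul' _ _ (by simpa using hV0)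
    _ = V⁻¹ * ∫⁻ z in Metric.ball 0 (2 * h), ∫⁻ x, ‖φ (x + z) - φ x‖ₑ ^ p ∂μ ∂μ := by
        rw [lintegral_lintegral_swap hm.aemeasurable]
    _ ≤ V⁻¹ * ∫⁻ _ in Metric.ball (0 : E) (2 * h), ENNReal.ofReal (2 * h) ^ p * I ∂μ := by
        gcongr V⁻¹ * ?_
        refine setLIntegral_mono' Metric.isOpen_ball.measurableSet fun z hz => ?_
        refine (lintegral_translate_sub_le μ hφ hp z).trans ?_
        gcongr
        rw [mem_ball_zero_iff] at hz
        rw [← ofReal_norm]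
        exact ENNReal.ofReal_le_ofReal hz.le
    _ = _ := by
        rw [setLIntegral_const, Measure.addHaar_ball_mul_of_pos μ 0 two_pos, ← hV]
        calc _ = V⁻¹ * V * (ENNReal.ofReal (2 ^ Module.finrank ℝ E) *
              (ENNReal.ofReal (2 * h) ^ p * I)) := by ring
          _ = _ := by rw [ENNReal.inv_mul_cancel hV0 hVt, one_mul]

theorem exists_setIntegralL {α : Type*} [MeasurableSpace α] (μ : Measure α) [IsFiniteMeasure μ]
    (q : ℝ≥0∞) [hq : Fact (1 ≤ q)] {B : Set α} (hB : MeasurableSet B) :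
    ∃ L : Lp ℝ q μ →L[ℝ] ℝ, ∀ u, L u = ∫ x in B, u x ∂μ := by
  have hc : (q.conjExponent).HolderConjugate q := (ENNReal.HolderConjugate.conjExponent hq.out).symm
  have : Fact (1 ≤ q.conjExponent) := ⟨hc.one_le⟩
  refine ⟨(ContinuousLinearMap.mul ℝ ℝ).lpPairing μ q.conjExponent q
    (indicatorConstLp _ hB (measure_ne_top μ B) 1), fun u => ?_⟩
  rw [ContinuousLinearMap.lpPairing_eq_integral, ← integral_indicator hB]
  refine integral_congr_ae ?_
  filter_upwards [indicatorConstLp_coeFn (p := q.conjExponent) (hs := hB)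
    (hμs := measure_ne_top μ B) (c := (1 : ℝ))] with x hx
  rw [hx]
  by_cases h : x ∈ B <;> simp [h]

theorem isCompactOperator_sum_smulRight {V W ι : Type*} [NormedAddCommGroup V] [NormedSpace ℝ V]
    [NormedAddCommGroup W] [NormedSpace ℝ W] (s : Finset ι) (L : ι → V →L[ℝ] ℝ) (χ : ι → W) :
    IsCompactOperator ⇑(∑ c ∈ s, (L c).smulRight (χ c)) := by
  classical
  induction s using Finset.induction_on with
  | empty =>
    rw [Finset.sum_empty]
    exact isCompactOperator_zero
  | insert a s ha ih =>
    rw [Finset.sum_insert ha]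
    refine IsCompactOperator.add ?_ ih
    exact (isCompactOperator_of_locallyCompactSpace_dom (L a)).clm_comp
      (ContinuousLinearMap.toSpanSingleton ℝ (χ a))

instance BoundedC2Domain.isFiniteMeasure_vol {N : ℕ} (Ω : BoundedC2Domain N) :
    IsFiniteMeasure Ω.vol :=
  ⟨by simpa using Ω.isBounded.measure_lt_top⟩

/-- Finitely many `h`-balls about points of a dense sequence cover the closure. The nearest point
among the terms up to the largest index used then defines a measurable map of finite range. -/
theorem exists_simpleFunc_dist_lt {E : Type*} [NormedAddCommGroup E] [NormedSpace ℝ E]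
    [FiniteDimensional ℝ E] [MeasurableSpace E] [BorelSpace E] {s : Set E}
    (hs : Bornology.IsBounded s) {h : ℝ} (hh : 0 < h) :
    ∃ i : SimpleFunc E E, ∀ x ∈ s, dist (i x) x < h := by
  obtain ⟨t, ht⟩ := hs.isCompact_closure.elim_finite_subcover
    (fun k => Metric.ball (TopologicalSpace.denseSeq E k) h) (fun _ => Metric.isOpen_ball)
    (fun x _ => by
      obtain ⟨k, hk⟩ :=
        (TopologicalSpace.denseRange_denseSeq E).exists_dist_lt x hh
      exact Set.mem_iUnion.2 ⟨k, hk⟩)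
  refine ⟨SimpleFunc.nearestPt (TopologicalSpace.denseSeq E) (t.sup id), fun x hx => ?_⟩
  obtain ⟨k, hkt, hk⟩ := Set.mem_iUnion₂.1 (ht (subset_closure hx))
  have h1 := SimpleFunc.edist_nearestPt_le (TopologicalSpace.denseSeq E) x
    (Finset.le_sup (f := id) hkt : k ≤ t.sup id)
  rw [edist_dist, edist_dist, ENNReal.ofReal_le_ofReal_iff dist_nonneg] at h1
  rw [Metric.mem_ball, dist_comm] at hk
  exact h1.trans_lt hk

/-- Averaging over the balls of a finite covering by small balls approximates the functions of
`W₀^{1,p}(Ω)` in `L^p(Ω)`, uniformly on bounded sets. -/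
theorem exists_compact_approx {N : ℕ} [NeZero N] (Ω : BoundedC2Domain N) (p : ℝ)
    [hpF : Fact (1 < p)] {ε : ℝ} (hε : 0 < ε) :
    ∃ P : Lp ℝ (ENNReal.ofReal p) Ω.vol →L[ℝ] Lp ℝ (ENNReal.ofReal p) Ω.vol,
      IsCompactOperator P ∧
      (∃ C : ℝ, 0 ≤ C ∧ ∀ u, ‖P u‖ ≤ C * ∫ x, |u x| ∂Ω.vol) ∧
      ∀ w ∈ sobolevPairs Ω p, ‖w.1 - P w.1‖ ≤ ε * ‖w.2‖ := by
  have hp : 1 < p := hpF.out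
  have hp0 : 0 < p := by linarith
  -- Chosen so that `2^N (2h)^p = 2^N (ε/2^N)^p ≤ ε^p`, which uses `p ≥ 1`.
  set h : ℝ := ε / 2 ^ N / 2 with hh_def
  have hh : 0 < h := by positivity
  obtain ⟨i, hi⟩ := exists_simpleFunc_dist_lt Ω.isBounded hh
  have hA : ∀ c, MeasurableSet (i ⁻¹' {c}) := fun c => i.measurableSet_fiber c
  choose L hL using fun c : EuclideanSpace ℝ (Fin N) =>
    exists_setIntegralL Ω.vol (ENNReal.ofReal p)
      (Metric.isOpen_ball (x := c) (ε := h)).measurableSet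
  set V := (volume (Metric.ball (0 : EuclideanSpace ℝ (Fin N)) h)).toReal with hV
  let χ : EuclideanSpace ℝ (Fin N) → Lp ℝ (ENNReal.ofReal p) Ω.vol := fun c =>
    indicatorConstLp _ (hA c) (measure_ne_top Ω.vol _) V⁻¹
  -- On the cell `i = c`, `P u` is the constant `V⁻¹ ∫ u` over the part of the ball about `c` inside
  -- the domain. Thus `P` has finite rank and sees `u` only through finitely many integrals, whence
  -- the `L¹` bound.
  let P := ∑ c ∈ i.range, (L c).smulRight (χ c)
  have hP : ∀ u, P u = ∑ c ∈ i.range, (∫ x in Metric.ball c h, u x ∂Ω.vol) • χ c := fun u => by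
    simp [P, hL]
  refine ⟨P, isCompactOperator_sum_smulRight _ _ _, ⟨∑ c ∈ i.range, ‖χ c‖,
    Finset.sum_nonneg fun _ _ => norm_nonneg _, fun u => ?_⟩, fun w hw => ?_⟩
  · rw [hP, Finset.sum_mul]
    refine (norm_sum_le _ _).trans (Finset.sum_le_sum fun c _ => ?_)
    rw [norm_smul, mul_comm]
    refine mul_le_mul_of_nonneg_left ?_ (norm_nonneg _)
    refine (norm_integral_le_integral_norm _).trans ?_
    exact setIntegral_le_integral ((Lp.memLp u).integrable Fact.out).norm
      (Eventually.of_forall fun _ => norm_nonneg _)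
  have hcl : IsClosed {v : Lp ℝ (ENNReal.ofReal p) Ω.vol ×
      Lp (EuclideanSpace ℝ (Fin N)) (ENNReal.ofReal p) Ω.vol | ‖v.1 - P v.1‖ ≤ ε * ‖v.2‖} :=
    isClosed_le (by fun_prop) (by fun_prop)
  have hw' : w ∈ closure (testPairs Ω p : Set (Lp ℝ (ENNReal.ofReal p) Ω.vol ×
      Lp (EuclideanSpace ℝ (Fin N)) (ENNReal.ofReal p) Ω.vol)) := by
    rw [← Submodule.topologicalClosure_coe]
    exact hw
  refine closure_minimal ?_ hcl hw'
  rintro v ⟨φ, hφ, h1, h2⟩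
  have hzero : ∀ x, x ∉ Ω.carrier → φ x = 0 := fun x hx =>
    image_eq_zero_of_notMem_tsupport fun h => hx (hφ.tsupport_subset h)
  -- Balls may leave the domain; the zero extension of a test function makes the truncated integral
  -- a full one.
  have hint : ∀ c, ∫ x in Metric.ball c h, v.1 x ∂Ω.vol = ∫ x in Metric.ball c h, φ x := by
    intro c
    rw [integral_congr_ae (ae_restrict_of_ae h1), Measure.restrict_restrict
      Metric.isOpen_ball.measurableSet]
    exact (setIntegral_eq_of_subset_of_forall_sdiff_eq_zero Metric.isOpen_ball.measurableSet
      Set.inter_subset_left fun x hx => hzero x fun hxΩ => hx.2 ⟨hx.1, hxΩ⟩).symm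
  have hPv : ∀ᵐ x ∂Ω.vol, P v.1 x = V⁻¹ * ∫ y in Metric.ball (i x) h, φ y := by
    have hsum : ∀ᵐ x ∂Ω.vol, P v.1 x =
        ∑ c ∈ i.range, ((∫ x in Metric.ball c h, v.1 x ∂Ω.vol) • χ c :
          Lp ℝ (ENNReal.ofReal p) Ω.vol) x := by
      rw [hP]
      exact Lp.coeFn_fun_finsetSum _ _
    have hterm : ∀ᵐ x ∂Ω.vol, ∀ c ∈ i.range,
        ((∫ x in Metric.ball c h, v.1 x ∂Ω.vol) • χ c : Lp ℝ (ENNReal.ofReal p) Ω.vol) x =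
          (∫ x in Metric.ball c h, φ x) * (i ⁻¹' {c}).indicator (fun _ => V⁻¹) x := by
      refine (Filter.eventually_all_finset _).2 fun c _ => ?_
      filter_upwards [Lp.coeFn_smul (∫ x in Metric.ball c h, v.1 x ∂Ω.vol) (χ c),
        indicatorConstLp_coeFn (p := ENNReal.ofReal p) (hs := hA c)
          (hμs := measure_ne_top Ω.vol _) (c := V⁻¹)] with x h3 h4
      rw [h3, Pi.smul_apply, h4, hint, smul_eq_mul]
    filter_upwards [hsum, hterm] with x h3 h4
    rw [h3, Finset.sum_congr rfl (h4), Finset.sum_eq_single (i x)]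
    · simp [mul_comm]
    · intro c _ hc
      have : x ∉ i ⁻¹' {c} := fun h => hc h.symm
      simp [this]
    · intro hx
      exact absurd (i.mem_range_self x) hx
  have hC1 : ContDiff ℝ 1 φ := hφ.contDiff.of_le (by simp)
  have key := lintegral_sub_average_ball_le volume hC1 hp.le Ω.isOpen.measurableSet hh hi
  have e1 : ‖v.1 - P v.1‖ₑ ^ p = ∫⁻ x in Ω.carrier, ‖φ x - V⁻¹ *
      ∫ y in Metric.ball (i x) h, φ y‖ₑ ^ p := by
    rw [Lp.enorm_def, eLpNorm_eq_lintegral_rpow_enorm_toReal (by simpa using hp0) (by simp),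
      ENNReal.toReal_ofReal hp0.le, ← ENNReal.rpow_mul, one_div_mul_cancel hp0.ne',
      ENNReal.rpow_one]
    refine lintegral_congr_ae ?_
    filter_upwards [Lp.coeFn_sub v.1 (P v.1), h1, hPv] with x h3 h4 h5
    rw [h3, Pi.sub_apply, h4, h5]
  have e2 : ‖v.2‖ₑ ^ p = ∫⁻ x, ‖fderiv ℝ φ x‖ₑ ^ p := by
    rw [Lp.enorm_def, eLpNorm_eq_lintegral_rpow_enorm_toReal (by simpa using hp0) (by simp),
      ENNReal.toReal_ofReal hp0.le, ← ENNReal.rpow_mul, one_div_mul_cancel hp0.ne',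
      ENNReal.rpow_one]
    have hz : ∀ x, x ∉ Ω.carrier → ‖fderiv ℝ φ x‖ₑ ^ p = 0 := fun x hx => by
      have hd : fderiv ℝ φ x = 0 := image_eq_zero_of_notMem_tsupport
        fun h => hx (hφ.tsupport_subset (tsupport_fderiv_subset ℝ h))
      rw [hd, ← ofReal_norm, norm_zero, ENNReal.ofReal_zero, ENNReal.zero_rpow_of_pos hp0]
    rw [← lintegral_add_compl (fun x => ‖fderiv ℝ φ x‖ₑ ^ p) Ω.isOpen.measurableSet,
      setLIntegral_congr_fun Ω.isOpen.measurableSet.compl (g := 0) (fun x hx => hz x hx)]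
    simp only [Pi.zero_apply, lintegral_zero, add_zero]
    refine lintegral_congr_ae (h2.mono fun x hx => ?_)
    have hn : ‖∇ φ x‖ₑ = ‖fderiv ℝ φ x‖ₑ := by
      rw [← ofReal_norm, ← ofReal_norm]
      simp [gradient]
    simp only [hx, hn]
  rw [← hV, ← e1, ← e2] at key
  have hconst : ENNReal.ofReal (2 ^ Module.finrank ℝ (EuclideanSpace ℝ (Fin N))) *
      ENNReal.ofReal (2 * h) ^ p ≤ ENNReal.ofReal ε ^ p := by
    rw [ENNReal.ofReal_rpow_of_nonneg (by positivity) hp0.le,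
      ENNReal.ofReal_rpow_of_nonneg hε.le hp0.le, ← ENNReal.ofReal_mul (by positivity)]
    refine ENNReal.ofReal_le_ofReal ?_
    rw [finrank_euclideanSpace_fin, hh_def, mul_div_cancel₀ _ two_ne_zero,
      Real.div_rpow hε.le (by positivity), mul_div_left_comm]
    refine mul_le_of_le_one_right (by positivity) ?_
    rw [div_le_one (by positivity)]
    exact Real.self_le_rpow_of_one_le (one_le_pow₀ one_le_two) hp.le
  have hfin : ‖v.1 - P v.1‖ₑ ^ p ≤ (ENNReal.ofReal ε * ‖v.2‖ₑ) ^ p := by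
    rw [ENNReal.mul_rpow_of_nonneg _ _ hp0.le]
    refine key.trans ?_
    rw [← mul_assoc]
    gcongr
  rw [ENNReal.rpow_le_rpow_iff hp0, ← ofReal_norm, ← ofReal_norm,
    ← ENNReal.ofReal_mul hε.le, ENNReal.ofReal_le_ofReal_iff (by positivity)] at hfin
  exact hfin

namespace SobolevW0

variable {N : ℕ} [NeZero N] {Ω : BoundedC2Domain N} {p : ℝ} [Fact (1 < p)]

theorem norm_toLp_le : ∃ C : ℝ, 0 ≤ C ∧ ∀ u : SobolevW0 Ω p, ‖u.toLp‖ ≤ C * ‖u‖ := by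
  obtain ⟨C, hC0, hC⟩ := poincare Ω p
  exact ⟨C, hC0, fun u => hC _ (u : ↥(sobolevPairs Ω p)).2⟩

/-- The embedding `W₀^{1,p}(Ω) ⊆ L^p(Ω)`. -/
noncomputable def toLpL : SobolevW0 Ω p →L[ℝ] Lp ℝ (ENNReal.ofReal p) Ω.vol :=
  toLp.mkContinuousOfExistsBound (norm_toLp_le.imp fun _ h => h.2)

/-- The weak gradient as an operator on `W₀^{1,p}(Ω)`. -/
noncomputable def gradL :
    SobolevW0 Ω p →L[ℝ] Lp (EuclideanSpace ℝ (Fin N)) (ENNReal.ofReal p) Ω.vol :=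
  grad.mkContinuousOfExistsBound ⟨1, fun u => by rw [one_mul, norm_def]⟩

@[simp] theorem toLpL_apply (u : SobolevW0 Ω p) : toLpL u = u.toLp := rfl

@[simp] theorem gradL_apply (u : SobolevW0 Ω p) : gradL u = u.grad := rfl

/-- The Rellich–Kondrachov theorem. -/
theorem isCompactOperator_toLpL : IsCompactOperator (toLpL : SobolevW0 Ω p →L[ℝ] _) := by
  -- Compact operators are closed in operator norm, and `P ∘ toLpL` approximates `toLpL` within
  -- `ε/2`.
  refine isClosed_setOfPred_isCompactOperator.closure_subset
    (Metric.mem_closure_iff.2 fun ε hε => ?_)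
  obtain ⟨P, hP, -, hb⟩ := exists_compact_approx Ω p (half_pos hε)
  refine ⟨P.comp toLpL, hP.comp_clm _, ?_⟩
  rw [dist_eq_norm]
  refine (ContinuousLinearMap.opNorm_le_bound _ (half_pos hε).le fun u => ?_).trans_lt
    (half_lt_self hε)
  exact hb _ (u : ↥(sobolevPairs Ω p)).2

theorem exists_subseq_tendsto_toLp {u : ℕ → SobolevW0 Ω p} {R : ℝ} (hu : ∀ n, ‖u n‖ ≤ R) :
    ∃ s : ℕ → ℕ, StrictMono s ∧ ∃ v, Tendsto (fun n => (u (s n)).toLp) atTop (𝓝 v) := by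
  obtain ⟨K, hK, hKs⟩ :=
    (isCompactOperator_toLpL (Ω := Ω) (p := p)).image_closedBall_subset_compact R
  obtain ⟨v, -, s, hs, hv⟩ := hK.tendsto_subseq (x := fun n => (u n).toLp)
    fun n => hKs ⟨u n, by simpa using hu n, rfl⟩
  exact ⟨s, hs, v, hv⟩

/-- Ehrling's inequality. -/
theorem norm_toLp_le_add {ε : ℝ} (hε : 0 < ε) : ∃ C : ℝ, 0 ≤ C ∧ ∀ u : SobolevW0 Ω p,
    ‖u.toLp‖ ≤ ε * ‖u‖ + C * ∫ x, |u.toLp x| ∂Ω.vol := by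
  -- Split `u = (u - Pu) + Pu`: the first part is small relative to `‖Du‖_p`, the second is bounded
  -- by the `L¹` norm.
  obtain ⟨P, -, ⟨C, hC0, hC⟩, hb⟩ := exists_compact_approx Ω p hε
  refine ⟨C, hC0, fun u => ?_⟩
  have h1 : ‖u.toLp - P u.toLp‖ ≤ ε * ‖u‖ := hb _ (u : ↥(sobolevPairs Ω p)).2
  have h2 := norm_add_le (u.toLp - P u.toLp) (P u.toLp)
  rw [sub_add_cancel] at h2
  linarith [hC u.toLp]

end SobolevW0

/-! ### The reaction term -/

/-- Setting `f` to zero on one measurable null set yields continuity and measurability everywhere,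
hence joint measurability. Only the countably many rational `x` need a measurable representative;
continuity supplies the other values. -/
theorem IsCaratheodory.exists_measurable_version {N : ℕ} {Ω : BoundedC2Domain N}
    {f : EuclideanSpace ℝ (Fin N) → ℝ → ℝ} (hf : IsCaratheodory Ω f) :
    ∃ f' : EuclideanSpace ℝ (Fin N) → ℝ → ℝ, (∀ z, Continuous (f' z)) ∧
      (∀ x, Measurable fun z => f' z x) ∧ ∀ᵐ z ∂Ω.vol, f' z = f z := by
  classical
  have hae : ∀ᵐ z ∂Ω.vol, Continuous (f z) ∧ ∀ q : ℚ, f z q = (hf.1 q).mk _ z :=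
    hf.2.and (ae_all_iff.2 fun q => (hf.1 q).ae_eq_mk)
  obtain ⟨T, hT, hTm, hT0⟩ := exists_measurable_superset_of_null (ae_iff.1 hae)
  have hgood : ∀ z, z ∉ T → Continuous (f z) ∧ ∀ q : ℚ, f z q = (hf.1 q).mk _ z := fun z hz =>
    by_contra fun h => hz (hT h)
  have hc : ∀ z, Continuous (Tᶜ.indicator f z) := fun z => by
    by_cases hz : z ∈ Tᶜ
    · rw [Set.indicator_of_mem hz]
      exact (hgood z hz).1
    · rw [Set.indicator_of_notMem hz]
      exact continuous_const
  have hq : ∀ q : ℚ, Measurable fun z => Tᶜ.indicator f z q := fun q => by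
    have e : (fun z => Tᶜ.indicator f z q) = Tᶜ.indicator ((hf.1 q).mk _) := by
      ext z
      by_cases hz : z ∈ Tᶜ
      · rw [Set.indicator_of_mem hz, Set.indicator_of_mem hz, (hgood z hz).2]
      · rw [Set.indicator_of_notMem hz, Set.indicator_of_notMem hz, Pi.zero_apply]
    rw [e]
    exact (hf.1 q).measurable_mk.indicator hTm.compl
  refine ⟨Tᶜ.indicator f, hc, fun x => ?_, ?_⟩
  · obtain ⟨r, hr, hrx⟩ := mem_closure_iff_seq_limit.1 (Rat.isDenseEmbedding_coe_real.dense x)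
    choose s hs using hr
    refine measurable_of_tendsto_metrizable (f := fun n z => Tᶜ.indicator f z (r n))
      (fun n => ?_) (tendsto_pi_nhds.2 fun z => ((hc z).tendsto x).comp hrx)
    rw [← hs n]
    exact hq (s n)
  · filter_upwards [measure_eq_zero_iff_ae_notMem.1 hT0] with z hz
    exact Set.indicator_of_mem hz f

theorem measurable_primitive {N : ℕ} {f : EuclideanSpace ℝ (Fin N) → ℝ → ℝ}
    (hf : Measurable (Function.uncurry f)) (x : ℝ) : Measurable fun z => primitive f z x := by
  unfold primitive
  simp only [intervalIntegral]
  exact (hf.stronglyMeasurable.integral_prod_right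
    (ν := volume.restrict (Set.Ioc 0 x))).measurable.sub (hf.stronglyMeasurable.integral_prod_right (ν := volume.restrict (Set.Ioc x 0))).measurable

theorem hasDerivAt_primitive {N : ℕ} {f : EuclideanSpace ℝ (Fin N) → ℝ → ℝ}
    {z : EuclideanSpace ℝ (Fin N)} (hf : Continuous (f z)) (x : ℝ) :
    HasDerivAt (primitive f z) (f z x) x :=
  intervalIntegral.integral_hasDerivAt_right (hf.intervalIntegrable 0 x)
    (hf.stronglyMeasurableAtFilter _ _) hf.continuousAt

theorem abs_primitive_le {N : ℕ} {f : EuclideanSpace ℝ (Fin N) → ℝ → ℝ}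
    {z : EuclideanSpace ℝ (Fin N)} {p C : ℝ} (hp : 1 < p) (hC : 0 ≤ C)
    (hb : ∀ x, |f z x| ≤ C * (1 + |x| ^ (p - 1))) (x : ℝ) :
    |primitive f z x| ≤ C * (1 + |x| ^ (p - 1)) * |x| := by
  have h := intervalIntegral.norm_integral_le_of_norm_le_const (a := 0) (b := x) (f := f z)
    (C := C * (1 + |x| ^ (p - 1))) fun t ht => ?_
  · rw [sub_zero] at h
    exact h
  · have h1 : |t| ≤ |x| := by
      rcases le_total 0 x with h0 | h0
      · rw [Set.uIoc_of_le h0] at ht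
        rw [abs_of_pos ht.1, abs_of_nonneg h0]
        exact ht.2
      · rw [Set.uIoc_of_ge h0] at ht
        rw [abs_of_nonpos ht.2, abs_of_nonpos h0]
        linarith [ht.1]
    refine (hb t).trans ?_
    have := Real.rpow_le_rpow (abs_nonneg t) h1 (by linarith : 0 ≤ p - 1)
    gcongr

theorem one_add_rpow_mul_le {p t : ℝ} (hp : 1 < p) (ht : 0 ≤ t) :
    (1 + t ^ (p - 1)) * t ≤ 2 * (1 + t ^ p) := by
  have h1 : t ^ (p - 1) * t = t ^ p := by
    rcases ht.eq_or_lt with h0 | h0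
    · simp [← h0, Real.zero_rpow (by linarith : p ≠ 0)]
    · rw [← Real.rpow_add_one h0.ne', sub_add_cancel]
  have h2 : t ≤ 1 + t ^ p := by
    rcases le_total t 1 with h | h
    · linarith [Real.rpow_nonneg ht p]
    · linarith [Real.self_le_rpow_of_one_le h hp.le]
  have h3 := Real.rpow_nonneg ht p
  linarith

/-- The factor `2` in the constant comes from `(1 + t^(p-1)) t ≤ 2(1 + t^p)` in the bound for the
primitive. -/
theorem isPotential_primitive {N : ℕ} {Ω : BoundedC2Domain N}
    {f : EuclideanSpace ℝ (Fin N) → ℝ → ℝ} (hc : ∀ z, Continuous (f z))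
    (hm : ∀ x, Measurable fun z => f z x) {p C : ℝ} (hp : 1 < p) (hC : 0 ≤ C)
    (hb : ∀ᵐ z ∂Ω.vol, ∀ x, |f z x| ≤ C * (1 + |x| ^ (p - 1))) :
    IsPotential Ω.vol p (2 * C) (primitive f)
      (fun z x => ContinuousLinearMap.toSpanSingleton ℝ (f z x)) where
  hasFDerivAt := Eventually.of_forall fun z x => hasDerivAt_primitive (hc z) x
  continuous := Eventually.of_forall fun z =>
    (ContinuousLinearMap.toSpanSingletonCLE (𝕜 := ℝ) (E := ℝ)).continuous.comp (hc z)
  meas := fun v hv => by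
    have hj : Measurable (Function.uncurry fun z x => f z x) :=
      (measurable_uncurry_of_continuous_of_measurable hc hm).comp measurable_swap
    have h1 : Measurable (Function.uncurry fun x z => primitive f z x) :=
      measurable_uncurry_of_continuous_of_measurable (fun z => continuous_iff_continuousAt.2
        fun x => (hasDerivAt_primitive (hc z) x).continuousAt) fun x => measurable_primitive hj x
    exact (h1.comp_aemeasurable (hv.aemeasurable.prodMk aemeasurable_id)).aestronglyMeasurable
  meas_deriv := fun v hv => by
    have h1 : Measurable (Function.uncurry fun x z => f z x) :=
      measurable_uncurry_of_continuous_of_measurable hc hm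
    exact (ContinuousLinearMap.toSpanSingletonCLE (𝕜 := ℝ) (E := ℝ)).continuous
      |>.comp_aestronglyMeasurable (h1.comp_aemeasurable (hv.aemeasurable.prodMk aemeasurable_id)).aestronglyMeasurable
  bound := hb.mono fun z hz x => by
    rw [Real.norm_eq_abs, Real.norm_eq_abs]
    have := abs_primitive_le hp hC hz x
    have := mul_le_mul_of_nonneg_left (one_add_rpow_mul_le hp (abs_nonneg x)) hC
    linarith
  bound_deriv := hb.mono fun z hz x => by
    rw [ContinuousLinearMap.norm_toSpanSingleton, Real.norm_eq_abs, Real.norm_eq_abs]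
    have : 0 ≤ C * (1 + |x| ^ (p - 1)) := by positivity
    linarith [hz x]

/-- For `|x| ≥ M` the quotient is within `1` of `l`; for `|x| ≤ M` the essential supremum of `a`
bounds `f`. -/
theorem abs_le_of_asymptotics {N : ℕ} {Ω : BoundedC2Domain N} {p l : ℝ}
    {f : EuclideanSpace ℝ (Fin N) → ℝ → ℝ}
    (h_i : ∀ ρ : ℝ, 0 < ρ → ∃ a : EuclideanSpace ℝ (Fin N) → ℝ,
      MemLp a ∞ Ω.vol ∧ (∀ᵐ z ∂Ω.vol, 0 ≤ a z) ∧
      ∀ᵐ z ∂Ω.vol, ∀ x : ℝ, |x| ≤ ρ → |f z x| ≤ a z)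
    (h_ii : ∀ ε : ℝ, 0 < ε → ∃ M : ℝ, 0 < M ∧
      ∀ᵐ z ∂Ω.vol, ∀ x : ℝ, M ≤ |x| → |f z x / (|x| ^ (p - 2) * x) - l| < ε) :
    ∃ C : ℝ, 0 ≤ C ∧ ∀ᵐ z ∂Ω.vol, ∀ x, |f z x| ≤ C * (1 + |x| ^ (p - 1)) := by
  obtain ⟨M, hM, hMf⟩ := h_ii 1 one_pos
  obtain ⟨a, ha, -, haf⟩ := h_i M hM
  have hab : ∀ᵐ z ∂Ω.vol, ‖a z‖ ≤ (eLpNorm a ⊤ Ω.vol).toReal := by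
    filter_upwards [ae_le_eLpNormEssSup (f := a) (μ := Ω.vol)] with z hz
    rw [← eLpNorm_exponent_top] at hz
    simpa using ENNReal.toReal_mono ha.2.ne hz
  refine ⟨(eLpNorm a ⊤ Ω.vol).toReal + (|l| + 1), by positivity, ?_⟩
  filter_upwards [hMf, haf, hab] with z h1 h2 h3 x
  have h0 : 0 ≤ |x| ^ (p - 1) := by positivity
  have h0' : 0 ≤ (eLpNorm a ⊤ Ω.vol).toReal := ENNReal.toReal_nonneg
  rcases le_total |x| M with h | h
  · have h4 := (h2 x h).trans ((le_abs_self _).trans h3)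
    nlinarith [abs_nonneg l]
  · have hx : 0 < |x| := hM.trans_le h
    have h5 : |f z x / (|x| ^ (p - 2) * x)| ≤ |l| + 1 := by
      have := abs_sub_abs_le_abs_sub (f z x / (|x| ^ (p - 2) * x)) l
      linarith [h1 x h]
    have h6 : |(|x| ^ (p - 2) * x)| = |x| ^ (p - 1) := by
      rw [abs_mul, abs_of_nonneg (by positivity : 0 ≤ |x| ^ (p - 2)),
        ← Real.rpow_add_one hx.ne']
      congr 1
      ring
    rw [abs_div, h6, div_le_iff₀ (by positivity)] at h5
    nlinarith [abs_nonneg l]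

/-- A linear lower bound suffices for the `L¹` estimate, and `|x|^τ ≥ |x| - 1` provides it for large
`|x|`. -/
theorem le_mul_sub_mul_primitive {N : ℕ} {Ω : BoundedC2Domain N} {p C τ β₀ : ℝ} (hp : 1 < p)
    (hC : 0 ≤ C) {f : EuclideanSpace ℝ (Fin N) → ℝ → ℝ}
    (hb : ∀ᵐ z ∂Ω.vol, ∀ x, |f z x| ≤ C * (1 + |x| ^ (p - 1))) (hτ : 1 ≤ τ) (hβ : 0 < β₀)
    (h_iii : ∀ ε : ℝ, 0 < ε → ∃ M : ℝ, 0 < M ∧ ∀ᵐ z ∂Ω.vol, ∀ x : ℝ, M ≤ |x| →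
      β₀ - ε < (f z x * x - p * primitive f z x) / |x| ^ τ) :
    ∃ K : ℝ, ∀ᵐ z ∂Ω.vol, ∀ x, β₀ / 2 * |x| - K ≤ f z x * x - p * primitive f z x := by
  obtain ⟨M, hM, hMf⟩ := h_iii (β₀ / 2) (by positivity)
  -- The `M` pays for `|x| ≤ M`, the `1` for the loss in `|x|^τ ≥ |x| - 1`; the last summand bounds
  -- both `f x` and `pF` when `|x| ≤ M`.
  refine ⟨β₀ / 2 * (M + 1) + (1 + p) * (C * (2 * (1 + M ^ p))), ?_⟩
  filter_upwards [hb, hMf] with z h1 h2 x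
  have hM0 : 0 ≤ C * (2 * (1 + M ^ p)) := by positivity
  rcases le_total |x| M with h | h
  · have h3 := abs_primitive_le hp hC h1 x
    have h4 : |f z x * x| ≤ C * (1 + |x| ^ (p - 1)) * |x| := by
      rw [abs_mul]
      exact mul_le_mul_of_nonneg_right (h1 x) (abs_nonneg x)
    have h5 : C * (1 + |x| ^ (p - 1)) * |x| ≤ C * (2 * (1 + M ^ p)) := by
      rw [mul_assoc]
      refine mul_le_mul_of_nonneg_left ((one_add_rpow_mul_le hp (abs_nonneg x)).trans ?_) hC
      have := Real.rpow_le_rpow (abs_nonneg x) h (by linarith : 0 ≤ p)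
      linarith
    have h6 := neg_abs_le (f z x * x)
    have h7 : p * primitive f z x ≤ p * (C * (2 * (1 + M ^ p))) :=
      mul_le_mul_of_nonneg_left ((le_abs_self _).trans (h3.trans h5)) (by linarith)
    nlinarith
  · have hx : 0 < |x| := hM.trans_le h
    have h3 := h2 x h
    rw [lt_div_iff₀ (by positivity)] at h3
    have h4 : |x| - 1 ≤ |x| ^ τ := by
      rcases le_total |x| 1 with h5 | h5
      · linarith [Real.rpow_nonneg hx.le τ]
      · linarith [Real.self_le_rpow_of_one_le h5 hτ]
    have h5 : 0 ≤ (1 + p) * (C * (2 * (1 + M ^ p))) := by positivity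
    nlinarith

/-! ### The differential part -/

section PLaplacian

variable {E : Type*} [NormedAddCommGroup E] [InnerProductSpace ℝ E]

/-- The differential of `ξ ↦ ‖ξ‖^p / p + ‖ξ‖² / 2`. -/
noncomputable def doublePhase (p : ℝ) (ξ : E) : E →L[ℝ] ℝ := (‖ξ‖ ^ (p - 2) + 1) • innerSL ℝ ξ

theorem doublePhase_apply (p : ℝ) (ξ η : E) :
    doublePhase p ξ η = (‖ξ‖ ^ (p - 2) + 1) * inner ℝ ξ η := by
  simp [doublePhase]

theorem rpow_sub_two_mul_sq {p t : ℝ} (hp : 2 < p) (ht : 0 ≤ t) : t ^ (p - 2) * t ^ 2 = t ^ p := by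
  rcases ht.eq_or_lt with h0 | h0
  · simp [← h0, Real.zero_rpow (by linarith : p ≠ 0)]
  · rw [← Real.rpow_natCast, ← Real.rpow_add h0]
    norm_num

theorem continuous_doublePhase {p : ℝ} (hp : 2 < p) :
    Continuous (doublePhase p : E → E →L[ℝ] ℝ) :=
  ((continuous_norm.rpow_const fun _ => Or.inr (by linarith)).add continuous_const).smul
    (innerSL ℝ).continuous

/-- Symmetrising, the pairing is `½(‖a‖^(p-2) + ‖b‖^(p-2))‖a-b‖²`, plus `½(‖a‖^(p-2) -
‖b‖^(p-2))(‖a‖² - ‖b‖²) ≥ 0`, plus `‖a-b‖²`. The first term alone gives the bound, through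
`‖a-b‖^(p-2) ≤ 2^(p-2)(‖a‖^(p-2) + ‖b‖^(p-2))`. -/
theorem doublePhase_monotone {p : ℝ} (hp : 2 < p) (a b : E) :
    (2 ^ (p - 1))⁻¹ * ‖a - b‖ ^ p ≤ (doublePhase p a - doublePhase p b) (a - b) := by
  have h1 : ∀ s t : ℝ, 0 ≤ s → 0 ≤ t → 0 ≤ (s ^ (p - 2) - t ^ (p - 2)) * (s ^ 2 - t ^ 2) := by
    intro s t hs ht
    rcases le_total s t with h | h
    · refine mul_nonneg_of_nonpos_of_nonpos ?_ ?_
      · linarith [Real.rpow_le_rpow hs h (by linarith : 0 ≤ p - 2)]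
      · nlinarith
    · refine mul_nonneg ?_ ?_
      · linarith [Real.rpow_le_rpow ht h (by linarith : 0 ≤ p - 2)]
      · nlinarith
  have h2 : ‖a - b‖ ^ (p - 2) ≤ 2 ^ (p - 2) * (‖a‖ ^ (p - 2) + ‖b‖ ^ (p - 2)) := by
    have key : ∀ s t : ℝ, 0 ≤ s → s ≤ t → (s + t) ^ (p - 2) ≤
        2 ^ (p - 2) * (s ^ (p - 2) + t ^ (p - 2)) := by
      intro s t hs hst
      calc (s + t) ^ (p - 2) ≤ (2 * t) ^ (p - 2) :=
            Real.rpow_le_rpow (by linarith) (by linarith) (by linarith)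
        _ = 2 ^ (p - 2) * t ^ (p - 2) := Real.mul_rpow (by norm_num) (by linarith)
        _ ≤ _ := by
            have := Real.rpow_nonneg hs (p - 2)
            gcongr
            linarith
    refine (Real.rpow_le_rpow (norm_nonneg _) (norm_sub_le a b) (by linarith)).trans ?_
    rcases le_total ‖a‖ ‖b‖ with h | h
    · exact key _ _ (norm_nonneg _) h
    · rw [add_comm ‖a‖, add_comm (‖a‖ ^ (p - 2))]
      exact key _ _ (norm_nonneg _) h
  have h3 := norm_sub_sq_real a b
  have h4 := h1 ‖a‖ ‖b‖ (norm_nonneg _) (norm_nonneg _)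
  have h5 : (doublePhase p a - doublePhase p b) (a - b) =
      1 / 2 * (‖a‖ ^ (p - 2) + ‖b‖ ^ (p - 2)) * ‖a - b‖ ^ 2 +
      1 / 2 * ((‖a‖ ^ (p - 2) - ‖b‖ ^ (p - 2)) * (‖a‖ ^ 2 - ‖b‖ ^ 2)) + ‖a - b‖ ^ 2 := by
    rw [sub_apply, doublePhase_apply, doublePhase_apply, inner_sub_right,
      inner_sub_right, real_inner_self_eq_norm_sq, real_inner_self_eq_norm_sq,
      real_inner_comm a b, h3]
    ring
  have h6 : (2 : ℝ) ^ (p - 1) = 2 ^ (p - 2) * 2 := by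
    rw [← Real.rpow_add_one two_ne_zero]
    congr 1
    ring
  rw [h5, ← rpow_sub_two_mul_sq hp (norm_nonneg (a - b)), h6]
  have h7 : (2 ^ (p - 2) * 2)⁻¹ * (‖a - b‖ ^ (p - 2) * ‖a - b‖ ^ 2) ≤
      1 / 2 * (‖a‖ ^ (p - 2) + ‖b‖ ^ (p - 2)) * ‖a - b‖ ^ 2 := by
    rw [← mul_assoc]
    refine mul_le_mul_of_nonneg_right ?_ (sq_nonneg _)
    rw [inv_mul_le_iff₀ (by positivity)]
    linarith
  linarith [sq_nonneg ‖a - b‖]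

theorem isPotential_doublePhase {α : Type*} [MeasurableSpace α] (μ : Measure α) {p : ℝ}
    (hp : 2 < p) : IsPotential μ p 2 (fun _ (ξ : E) => 1 / p * ‖ξ‖ ^ p + 1 / 2 * ‖ξ‖ ^ 2)
      (fun _ => doublePhase p) where
  hasFDerivAt := Eventually.of_forall fun z x => by
    have h1 := ((hasFDerivAt_norm_rpow x (by linarith : 1 < p)).const_mul (1 / p)).fun_add
      ((hasStrictFDerivAt_norm_sq x).hasFDerivAt.const_mul (1 / 2))
    refine h1.congr_fderiv ?_
    ext y
    have : p ≠ 0 := by linarith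
    simp [doublePhase]
    field_simp
  continuous := Eventually.of_forall fun z => continuous_doublePhase hp
  meas := fun v hv => by
    have : Continuous fun ξ : E => 1 / p * ‖ξ‖ ^ p + 1 / 2 * ‖ξ‖ ^ 2 :=
      (continuous_const.mul (continuous_norm.rpow_const fun _ => Or.inr (by linarith))).add
        (by fun_prop)
    exact this.comp_aestronglyMeasurable hv
  meas_deriv := fun v hv => (continuous_doublePhase hp).comp_aestronglyMeasurable hv
  bound := Eventually.of_forall fun z x => by
    have h1 : ‖x‖ ^ 2 ≤ 1 + ‖x‖ ^ p := by
      rcases le_total ‖x‖ 1 with h | h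
      · have := Real.rpow_nonneg (norm_nonneg x) p
        nlinarith [norm_nonneg x]
      · have := Real.rpow_le_rpow_of_exponent_le h hp.le
        rw [Real.rpow_two] at this
        linarith
    have h2 := Real.rpow_nonneg (norm_nonneg x) p
    rw [Real.norm_of_nonneg (by positivity)]
    have h3 : 1 / p ≤ 1 := by
      rw [div_le_one (by linarith)]
      linarith
    nlinarith
  bound_deriv := Eventually.of_forall fun z x => by
    have h0 := norm_nonneg x
    have h1 : ‖x‖ ^ (p - 2) * ‖x‖ = ‖x‖ ^ (p - 1) := by
      rcases h0.eq_or_lt with h | h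
      · simp [← h, Real.zero_rpow (by linarith : p - 1 ≠ 0)]
      · rw [← Real.rpow_add_one h.ne']
        congr 1
        ring
    have h2 : ‖x‖ ≤ 1 + ‖x‖ ^ (p - 1) := by
      rcases le_total ‖x‖ 1 with h | h
      · linarith [Real.rpow_nonneg h0 (p - 1)]
      · linarith [Real.self_le_rpow_of_one_le h (by linarith : 1 ≤ p - 1)]
    rw [doublePhase, norm_smul, innerSL_apply_norm, Real.norm_of_nonneg (by positivity)]
    linarith

end PLaplacian

/-! ### Differentiability of the energy functional -/

namespace SobolevW0

variable {N : ℕ} {Ω : BoundedC2Domain N} {p : ℝ} [hpF : Fact (1 < p)]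

theorem integrable_norm_grad_rpow (u : SobolevW0 Ω p) :
    Integrable (fun z => ‖u.grad z‖ ^ p) Ω.vol := by
  have hp0 : 0 < p := by linarith [hpF.out]
  simpa [ENNReal.toReal_ofReal hp0.le] using
    (Lp.memLp u.grad).integrable_norm_rpow (by simpa using hp0) (by simp)

theorem integrable_norm_grad_sq (hp : 2 < p) (u : SobolevW0 Ω p) :
    Integrable (fun z => ‖u.grad z‖ ^ 2) Ω.vol := by
  have h : MemLp (fun z => u.grad z) 2 Ω.vol := (Lp.memLp u.grad).mono_exponent (by
    rw [← ENNReal.ofReal_ofNat 2]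
    exact ENNReal.ofReal_le_ofReal hp.le)
  exact h.integrable_norm_pow (by norm_num)

variable [NeZero N]

theorem energy_eq (hp : 2 < p) (f : EuclideanSpace ℝ (Fin N) → ℝ → ℝ) (u : SobolevW0 Ω p) :
    energy Ω p f u = (∫ z, (1 / p * ‖gradL u z‖ ^ p + 1 / 2 * ‖gradL u z‖ ^ 2) ∂Ω.vol) -
      ∫ z, primitive f z (toLpL u z) ∂Ω.vol := by
  simp only [gradL_apply, toLpL_apply]
  rw [integral_add (u.integrable_norm_grad_rpow.const_mul _)
    ((u.integrable_norm_grad_sq hp).const_mul _), integral_const_mul, integral_const_mul]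
  rfl

/-- The reaction part `B` is kept as a continuous map on `L^p`, so that convergence in `L^p` alone
forces convergence of this part of the derivative. -/
theorem exists_hasFDerivAt_energy (hp : 2 < p) {f : EuclideanSpace ℝ (Fin N) → ℝ → ℝ} {C : ℝ}
    (hF : IsPotential Ω.vol p C (primitive f)
      fun z x => ContinuousLinearMap.toSpanSingleton ℝ (f z x)) :
    ∃ (A : SobolevW0 Ω p → SobolevW0 Ω p →L[ℝ] ℝ)
      (B : Lp ℝ (ENNReal.ofReal p) Ω.vol → Lp ℝ (ENNReal.ofReal p) Ω.vol →L[ℝ] ℝ),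
      Continuous A ∧ Continuous B ∧
      (∀ u v, A u v = ∫ z, doublePhase p (u.grad z) (v.grad z) ∂Ω.vol) ∧
      (∀ u v, B u v = ∫ z, v z * f z (u z) ∂Ω.vol) ∧
      ∀ u, HasFDerivAt (energy Ω p f) (A u - (B u.toLp).comp toLpL) u := by
  obtain ⟨A, hAc, hA, hA'⟩ := (isPotential_doublePhase (E := EuclideanSpace ℝ (Fin N))
    Ω.vol hp).exists_hasFDerivAt
  obtain ⟨B, hBc, hB, hB'⟩ := hF.exists_hasFDerivAt
  refine ⟨fun u => (A (gradL u)).comp gradL, B, ?_, hBc, fun u v => hA _ _, fun u v => ?_,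
    fun u => ?_⟩
  · exact (hAc.comp gradL.continuous).clm_comp continuous_const
  · rw [hB]
    simp
  · have h1 := ((hA' (gradL u)).comp u gradL.hasFDerivAt).fun_sub
      ((hB' (toLpL u)).comp u toLpL.hasFDerivAt)
    rw [funext fun u => energy_eq hp f u]
    exact h1

end SobolevW0

/-! ### Boundedness and convergence of Cerami sequences -/

/-- The absorption step: `εt + K` is at most `2εt` or `2K`, and `a(2ε)^p ≤ 2aε ≤ 1/2` by the choice
of `ε`, so half of `t^p` survives on the left. -/
theorem le_of_rpow_le_add_mul_rpow {p a b ε K t : ℝ} (hp : 1 ≤ p) (ha : 0 ≤ a) (hK : 0 ≤ K)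
    (hε : ε = 1 / (2 * (2 * a + 1))) (ht : 0 ≤ t) (h : t ^ p ≤ b + a * (ε * t + K) ^ p) :
    t ≤ 1 + 2 * (b + a * (2 * K) ^ p) := by
  have hp0 : 0 ≤ p := by linarith
  have hε0 : 0 < ε := by rw [hε]; positivity
  have h1 : (ε * t + K) ^ p ≤ (2 * ε) ^ p * t ^ p + (2 * K) ^ p := by
    rw [← Real.mul_rpow (by positivity) ht]
    have h2 : 0 ≤ (2 * ε * t) ^ p := by positivity
    have h3 : 0 ≤ (2 * K) ^ p := by positivity
    rcases le_total (ε * t) K with hl | hl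
    · have := Real.rpow_le_rpow (by positivity) (by linarith : ε * t + K ≤ 2 * K) hp0
      linarith
    · have := Real.rpow_le_rpow (by positivity) (by linarith : ε * t + K ≤ 2 * ε * t) hp0
      linarith
  have h2 : (2 * ε) ^ p ≤ 2 * ε := by
    refine Real.rpow_le_self_of_le_one (by positivity) ?_ hp
    rw [hε, ← mul_div_assoc, mul_one, div_le_one (by positivity)]
    linarith
  have h3 : a * (2 * ε) ≤ 1 / 2 := by
    rw [hε]
    field_simp
    linarith
  have h4 : 0 ≤ t ^ p := by positivity
  have h5 : t ≤ 1 + t ^ p := by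
    rcases le_total t 1 with h | h
    · linarith
    · linarith [Real.self_le_rpow_of_one_le h hp]
  have h6 : a * (ε * t + K) ^ p ≤ 1 / 2 * t ^ p + a * (2 * K) ^ p := by
    have h7 := mul_le_mul_of_nonneg_left h1 ha
    have h8 : a * ((2 * ε) ^ p * t ^ p) ≤ 1 / 2 * t ^ p := by
      rw [← mul_assoc]
      exact mul_le_mul_of_nonneg_right ((mul_le_mul_of_nonneg_left h2 ha).trans h3) h4
    linarith
  linarith

theorem exists_norm_le_of_cerami {N : ℕ} [NeZero N] {Ω : BoundedC2Domain N} {p : ℝ}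
    [hpF : Fact (1 < p)] (hp : 2 < p) {f : EuclideanSpace ℝ (Fin N) → ℝ → ℝ} {C c K : ℝ}
    (hC : 0 ≤ C) (hc : 0 < c)
    (hF : IsPotential Ω.vol p (2 * C) (primitive f)
      fun z x => ContinuousLinearMap.toSpanSingleton ℝ (f z x))
    (hb : ∀ᵐ z ∂Ω.vol, ∀ x, |f z x| ≤ C * (1 + |x| ^ (p - 1)))
    (hlow : ∀ᵐ z ∂Ω.vol, ∀ x, c * |x| - K ≤ f z x * x - p * primitive f z x) (M S : ℝ) :
    ∃ R, ∀ u : SobolevW0 Ω p, |energy Ω p f u| ≤ M → |fderiv ℝ (energy Ω p f) u u| ≤ S →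
      ‖u‖ ≤ R := by
  have hp0 : 0 < p := by linarith
  obtain ⟨A, B, -, -, hA, hB, hD⟩ := SobolevW0.exists_hasFDerivAt_energy hp hF
  obtain ⟨CE, hCE0, hCE⟩ := SobolevW0.norm_toLp_le_add (Ω := Ω) (p := p)
    (ε := 1 / (2 * (2 * (2 * C) + 1))) (by positivity)
  set V := Ω.vol.real Set.univ with hV
  have hV0 : 0 ≤ V := measureReal_nonneg
  -- The `L¹` bound obtained by integrating the lower bound `c|u| - K` in `pφ(u) - φ'(u)u ≤ pM + S`.
  set K₁ := max ((p * M + S + K * V) / c) 0 with hK₁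
  have hK₁0 : 0 ≤ K₁ := le_max_right _ _
  set S' := max S 0
  have hS'0 : 0 ≤ S' := le_max_right _ _
  refine ⟨1 + 2 * ((S' + 2 * C * V) + 2 * C * (2 * (CE * K₁)) ^ p), fun u hM hS => ?_⟩
  set Q := ∫ z, ‖u.grad z‖ ^ 2 ∂Ω.vol with hQ
  have hQ0 : 0 ≤ Q := integral_nonneg fun z => by positivity
  have hun : ‖u‖ ^ p = ∫ z, ‖u.grad z‖ ^ p ∂Ω.vol := Lp_norm_rpow_eq hpF.out _
  have hlp : ‖u.toLp‖ ^ p = ∫ z, ‖u.toLp z‖ ^ p ∂Ω.vol := Lp_norm_rpow_eq hpF.out _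
  have hip : Integrable (fun z => ‖u.toLp z‖ ^ p) Ω.vol := by
    simpa [ENNReal.toReal_ofReal hp0.le] using
      (Lp.memLp u.toLp).integrable_norm_rpow (by simpa using hp0) (by simp)
  have hAu : A u u = ‖u‖ ^ p + Q := by
    rw [hA, hun, hQ, ← integral_add u.integrable_norm_grad_rpow (u.integrable_norm_grad_sq hp)]
    refine integral_congr_ae (Eventually.of_forall fun z => ?_)
    simp only [doublePhase_apply, real_inner_self_eq_norm_sq, add_mul, one_mul,
      rpow_sub_two_mul_sq hp (norm_nonneg _)]
  have hiB : Integrable (fun z => u.toLp z * f z (u.toLp z)) Ω.vol := by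
    have := hF.integrable_deriv hpF.out (Lp.memLp u.toLp) (Lp.memLp u.toLp)
    simpa using this
  have hiF : Integrable (fun z => primitive f z (u.toLp z)) Ω.vol :=
    hF.integrable hpF.out (Lp.memLp u.toLp)
  have hiu : Integrable (fun z => |u.toLp z|) Ω.vol :=
    ((Lp.memLp u.toLp).integrable Fact.out).norm
  have hder : fderiv ℝ (energy Ω p f) u u =
      ‖u‖ ^ p + Q - ∫ z, u.toLp z * f z (u.toLp z) ∂Ω.vol := by
    rw [(hD u).fderiv, sub_apply, hAu, ← hB]
    rfl
  have hen : energy Ω p f u = 1 / p * ‖u‖ ^ p + 1 / 2 * Q -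
      ∫ z, primitive f z (u.toLp z) ∂Ω.vol := by
    rw [hun]
    rfl
  have hL1 : ∫ z, |u.toLp z| ∂Ω.vol ≤ K₁ := by
    have h1 : ∫ z, (c * |u.toLp z| - K) ∂Ω.vol ≤
        ∫ z, (u.toLp z * f z (u.toLp z) - p * primitive f z (u.toLp z)) ∂Ω.vol := by
      refine integral_mono_ae ((hiu.const_mul c).sub (integrable_const K))
        (hiB.sub (hiF.const_mul p)) (hlow.mono fun z hz => ?_)
      have := hz (u.toLp z)
      simp only
      linarith
    rw [integral_sub (hiu.const_mul c) (integrable_const K), integral_sub hiB (hiF.const_mul p),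
      integral_const_mul, integral_const_mul, integral_const, smul_eq_mul] at h1
    -- The `p`-th powers of `Du` cancel, and the remaining gradient term has a positive coefficient
    -- because `p > 2`.
    have h2 : p * energy Ω p f u - fderiv ℝ (energy Ω p f) u u = (p / 2 - 1) * Q +
        ((∫ z, u.toLp z * f z (u.toLp z) ∂Ω.vol) - p * ∫ z, primitive f z (u.toLp z) ∂Ω.vol) := by
      rw [hen, hder]
      field_simp
      ring
    have h3 : 0 ≤ (p / 2 - 1) * Q := mul_nonneg (by linarith) hQ0
    have h4 : p * energy Ω p f u ≤ p * M :=
      mul_le_mul_of_nonneg_left ((le_abs_self _).trans hM) hp0.le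
    have h5 := (neg_abs_le (fderiv ℝ (energy Ω p f) u u))
    refine le_trans ?_ (le_max_left _ _)
    rw [le_div_iff₀ hc]
    linarith
  have hup : ‖u‖ ^ p ≤ (S' + 2 * C * V) + 2 * C * ‖u.toLp‖ ^ p := by
    have h1 : ∫ z, u.toLp z * f z (u.toLp z) ∂Ω.vol ≤
        ∫ z, 2 * C * (1 + ‖u.toLp z‖ ^ p) ∂Ω.vol := by
      refine integral_mono_ae hiB (((integrable_const 1).add hip).const_mul _)
        (hb.mono fun z hz => ?_)
      have h2 := mul_le_mul_of_nonneg_left (hz (u.toLp z)) (abs_nonneg (u.toLp z))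
      have h3 := mul_le_mul_of_nonneg_left
        (one_add_rpow_mul_le hpF.out (abs_nonneg (u.toLp z))) hC
      have h4 := le_abs_self (u.toLp z * f z (u.toLp z))
      rw [abs_mul] at h4
      simp only [Real.norm_eq_abs]
      linarith
    rw [integral_const_mul, integral_add (integrable_const 1) hip, ← hlp, integral_const,
      smul_eq_mul, mul_one] at h1
    have h2 := (le_abs_self _).trans (hS.trans (le_max_left S 0))
    rw [hder] at h2
    linarith
  refine le_of_rpow_le_add_mul_rpow hpF.out.le (by positivity) (by positivity)
    rfl (norm_nonneg u) (hup.trans ?_)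
  gcongr
  refine (hCE u).trans ?_
  gcongr

/-- Dividing the monotonicity inequality by `‖u - v‖` gives `c‖u - v‖^(p-1) ≤ ‖A u - A v‖`, so
convergence of the images controls the sequence itself; no weak limit is needed. -/
theorem cauchySeq_of_strongly_monotone {X : Type*} [NormedAddCommGroup X] [NormedSpace ℝ X]
    {p c : ℝ} (hp : 1 < p) (hc : 0 < c) {A : X → X →L[ℝ] ℝ}
    (hA : ∀ u v, c * ‖u - v‖ ^ p ≤ (A u - A v) (u - v)) {u : ℕ → X}
    (h : CauchySeq fun n => A (u n)) : CauchySeq u := by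
  rw [Metric.cauchySeq_iff] at h ⊢
  intro ε hε
  obtain ⟨n₀, hn₀⟩ := h (c * ε ^ (p - 1)) (by positivity)
  refine ⟨n₀, fun m hm n hn => ?_⟩
  have h1 := hn₀ m hm n hn
  rw [dist_eq_norm] at h1 ⊢
  by_contra! hle
  have hpos : 0 < ‖u m - u n‖ := hε.trans_le hle
  have h2 := (hA (u m) (u n)).trans ((le_abs_self _).trans
    ((A (u m) - A (u n)).le_opNorm (u m - u n)))
  have h3 : ‖u m - u n‖ ^ p = ‖u m - u n‖ ^ (p - 1) * ‖u m - u n‖ := by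
    rw [← Real.rpow_add_one hpos.ne', sub_add_cancel]
  rw [h3, ← mul_assoc] at h2
  have h4 := le_of_mul_le_mul_right h2 hpos
  have h5 := Real.rpow_le_rpow hε.le hle (by linarith : 0 ≤ p - 1)
  have h6 := mul_le_mul_of_nonneg_left h5 hc.le
  linarith

theorem satisfiesCerami_energy {N : ℕ} [NeZero N] {Ω : BoundedC2Domain N} {p : ℝ}
    [hpF : Fact (1 < p)] (hp : 2 < p) {f : EuclideanSpace ℝ (Fin N) → ℝ → ℝ} {C c K : ℝ}
    (hC : 0 ≤ C) (hc : 0 < c)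
    (hF : IsPotential Ω.vol p (2 * C) (primitive f)
      fun z x => ContinuousLinearMap.toSpanSingleton ℝ (f z x))
    (hb : ∀ᵐ z ∂Ω.vol, ∀ x, |f z x| ≤ C * (1 + |x| ^ (p - 1)))
    (hlow : ∀ᵐ z ∂Ω.vol, ∀ x, c * |x| - K ≤ f z x * x - p * primitive f z x) :
    SatisfiesCerami (energy Ω p f) := by
  obtain ⟨A, B, hAc, hBc, hA, hB, hD⟩ := SobolevW0.exists_hasFDerivAt_energy hp hF
  refine ⟨contDiff_one_iff_hasFDerivAt.2 ⟨_, hAc.sub ((hBc.comp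
    SobolevW0.toLpL.continuous).clm_comp continuous_const), hD⟩, fun u ⟨M, hM⟩ hu => ?_⟩
  obtain ⟨S, hS⟩ := hu.norm.bddAbove_range
  have hS' : ∀ n, (1 + ‖u n‖) * ‖fderiv ℝ (energy Ω p f) (u n)‖ ≤ S := fun n => by
    have : ‖(1 + ‖u n‖) • fderiv ℝ (energy Ω p f) (u n)‖ ≤ S := hS ⟨n, rfl⟩
    rwa [norm_smul, Real.norm_of_nonneg (by positivity)] at this
  obtain ⟨R, hR⟩ := exists_norm_le_of_cerami hp hC hc hF hb hlow M S
  obtain ⟨s, hs, w, hw⟩ := SobolevW0.exists_subseq_tendsto_toLp fun n => hR (u n) (hM n) (by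
    -- The Cerami weight is what bounds `φ'(u_n)u_n` before `u_n` is known to be bounded.
    refine ((fderiv ℝ (energy Ω p f) (u n)).le_opNorm (u n)).trans (le_trans ?_ (hS' n))
    rw [mul_comm]
    gcongr
    linarith)
  have hmono : ∀ u v : SobolevW0 Ω p, (2 ^ (p - 1))⁻¹ * ‖u - v‖ ^ p ≤ (A u - A v) (u - v) := by
    intro u v
    have hi : ∀ w : SobolevW0 Ω p,
        Integrable (fun z => doublePhase p (w.grad z) ((u - v).grad z)) Ω.vol := fun w =>
      (isPotential_doublePhase Ω.vol hp).integrable_deriv hpF.out (Lp.memLp w.grad)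
        (Lp.memLp (u - v).grad)
    have hn : ‖u - v‖ ^ p = ∫ z, ‖(u - v).grad z‖ ^ p ∂Ω.vol := Lp_norm_rpow_eq hpF.out _
    rw [sub_apply, hA, hA, ← integral_sub (hi u) (hi v), hn, ← integral_const_mul]
    refine integral_mono_ae ((u - v).integrable_norm_grad_rpow.const_mul _) ((hi u).sub (hi v)) ?_
    have hg : (u - v).grad = u.grad - v.grad := map_sub _ _ _
    filter_upwards [Lp.coeFn_sub u.grad v.grad] with z hz
    rw [hg, hz]
    exact doublePhase_monotone hp (u.grad z) (v.grad z)
  have hfd : Tendsto (fun n => fderiv ℝ (energy Ω p f) (u n)) atTop (𝓝 0) := by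
    refine squeeze_zero_norm (fun n => ?_) (by simpa using hu.norm)
    rw [norm_smul, Real.norm_of_nonneg (by positivity)]
    exact le_mul_of_one_le_left (norm_nonneg _) (by linarith [norm_nonneg (u n)])
  -- `A u = φ'(u) + B(u)` along the subsequence, where `φ'(u) → 0` and `B` is continuous on `L^p`.
  have hlim : Tendsto (fun n => A (u (s n))) atTop (𝓝 (0 + (B w).comp SobolevW0.toLpL)) := by
    have h1 : Tendsto (fun n => (B (u (s n)).toLp).comp (SobolevW0.toLpL (Ω := Ω) (p := p)))
        atTop (𝓝 ((B w).comp SobolevW0.toLpL)) :=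
      ((hBc.clm_comp continuous_const).tendsto w).comp hw
    refine ((hfd.comp hs.tendsto_atTop).add h1).congr fun n => ?_
    simp only [Function.comp_apply, (hD (u (s n))).fderiv, sub_add_cancel]
  obtain ⟨v, hv⟩ := cauchySeq_tendsto_of_complete
    (cauchySeq_of_strongly_monotone hpF.out (by positivity) hmono hlim.cauchySeq)
  exact ⟨s, hs, v, hv⟩

theorem proposition5 {N : ℕ} [NeZero N] (Ω : BoundedC2Domain N)
    (p : ℝ) [Fact (1 < p)] (hp : 2 < p)
    (f : EuclideanSpace ℝ (Fin N) → ℝ → ℝ) (hf : IsCaratheodory Ω f)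
    -- growth on bounded sets
    (h_i : ∀ ρ : ℝ, 0 < ρ → ∃ a : EuclideanSpace ℝ (Fin N) → ℝ,
      MemLp a ∞ Ω.vol ∧ (∀ᵐ z ∂Ω.vol, 0 ≤ a z) ∧
      ∀ᵐ z ∂Ω.vol, ∀ x : ℝ, |x| ≤ ρ → |f z x| ≤ a z)
    -- resonance at infinity with respect to a variational eigenvalue
    (h_ii : ∃ m : ℕ, 1 ≤ m ∧ ∀ ε : ℝ, 0 < ε → ∃ M : ℝ, 0 < M ∧
      ∀ᵐ z ∂Ω.vol, ∀ x : ℝ, M ≤ |x| →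
        |f z x / (|x| ^ (p - 2) * x) - variationalEigenvalue Ω p m| < ε)
    -- uniform lower bound for the limit inferior at infinity
    (h_iii : ∃ τ : ℝ, 2 < τ ∧ τ < p ∧ ∃ β₀ : ℝ, 0 < β₀ ∧
      ∀ ε : ℝ, 0 < ε → ∃ M : ℝ, 0 < M ∧ ∀ᵐ z ∂Ω.vol, ∀ x : ℝ, M ≤ |x| →
        β₀ - ε < (f z x * x - p * primitive f z x) / |x| ^ τ) :
    (∀ u : SobolevW0 Ω p, Integrable (fun z => primitive f z (u.toLp z)) Ω.vol) ∧
      SatisfiesCerami (energy Ω p f) := by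
  obtain ⟨m, -, h_ii⟩ := h_ii
  obtain ⟨τ, hτ, -, β₀, hβ, h_iii⟩ := h_iii
  -- The bounds and the energy depend on `f` only up to a null set of `z`, so the argument can run
  -- with the regular version `g`.
  obtain ⟨g, hgc, hgm, hgf⟩ := hf.exists_measurable_version
  obtain ⟨C, hC, hfb⟩ := abs_le_of_asymptotics h_i h_ii
  have hp1 : 1 < p := by linarith
  obtain ⟨K, hK⟩ := le_mul_sub_mul_primitive hp1 hC hfb (by linarith) hβ h_iii
  have hprim : ∀ᵐ z ∂Ω.vol, primitive g z = primitive f z := hgf.mono fun z hz => by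
    ext x
    simp only [primitive, hz]
  have hgb : ∀ᵐ z ∂Ω.vol, ∀ x, |g z x| ≤ C * (1 + |x| ^ (p - 1)) := by
    filter_upwards [hgf, hfb] with z hz h
    rwa [hz]
  have hgK : ∀ᵐ z ∂Ω.vol, ∀ x, β₀ / 2 * |x| - K ≤ g z x * x - p * primitive g z x := by
    filter_upwards [hgf, hprim, hK] with z hz hz' h
    rwa [hz, hz']
  have hG := isPotential_primitive hgc hgm hp1 hC hgb
  have hen : energy Ω p f = energy Ω p g := by
    ext u
    unfold energy
    congr 1
    exact integral_congr_ae (hprim.mono fun z hz => by simp only [hz])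
  refine ⟨fun u => (hG.integrable hp1 (Lp.memLp u.toLp)).congr
    (hprim.mono fun z hz => by simp only [hz]), ?_⟩
  rw [hen]
  exact satisfiesCerami_energy hp hC (half_pos hβ) hG hgb hgK
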